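/- Let $\mathcal S$ be a finite nonempty set and $\beta>0$. For every parameter $\alpha$ let $R^\alpha_{x\to y}\ge0$ ($x\ne y$ in $\mathcal S$) be transition rates such that $R^\alpha_{x\to y}\ne0$ implies $R^\alpha_{y\to x}\ne0$ and such that $\mathcal S$ is connected through nonvanishing rates. Let $\lambda^\alpha_x=\sum_{y\ne x}R^\alpha_{x\to y}$ be the escape rates and $\rho^\alpha$ the unique stationary distribution. Let $H^\nu_x\in\mathbb R$ be the energy of the state $x$, where $\nu$ is a component of $\alpha$, and for $R^\alpha_{x\to y}\neq 0$ put $$\psi^\alpha_{x\to y}=\log\frac{R^\alpha_{x\to y}}{R^\alpha_{y\to x}}-\beta\,(H^\nu_x-H^\nu_y).$$ A protocol $\hat\alpha=(\alpha(t))$, not necessarily continuous, satisfies $\alpha(t)=\alpha$ for $t\le-\tau_{\mathrm o}$ and $\alpha(t)=\alpha'$ for $t\ge\tau_{\mathrm o}$, for some $\tau_{\mathrm o}>0$; the rates and the energies along it are bounded measurable functions of $t$. Its time reversal is $\hat\alpha^\dagger=(\alpha(-t))$, and $(\alpha)$ denotes the constant protocol. A path $\hat x$ on $[s,e]$ consists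 of $n\ge0$ jumps, states $x_0,\dots,x_n$ with $x_{j-1}\ne x_j$, and jump times $s=t_0<t_1<\dots<t_n<t_{n+1}=e$. Its weight is $$\mathcal T^{\hat\alpha}[\hat x]=\prod_{j=1}^nR^{\alpha(t_j)}_{x_{j-1}\to x_j}\prod_{j=0}^n\exp\Bigl[-\int_{t_j}^{t_{j+1}}\lambda^{\alpha(t)}_{x_j}\,dt\Bigr],$$ and $\int\mathcal D\hat x$ denotes the sum over $n$ and over the states, and the integral over the jump times. Let $$W^{\hat\nu}[\hat x]=\sum_{j=0}^n\bigl(H^{\nu(t_{j+1})}_{x_j}-H^{\nu(t_j)}_{x_j}\bigr),\qquad \Psi^{[c,d],\hat\alpha}[\hat x]=\sum_{j:\,t_j\in[c,d]}\psi^{\alpha(t_j)}_{x_{j-1}\to x_j}.$$ On the interval $[s,e]$ write $\langle f\rangle_{x\to}=\int\mathcal D\hat x\,f\,\delta_{x_0,x}\,\mathcal T$, $\ \langle f\rangle_{\mathrm{st}\to}=\int\mathcal D\hat x\,f\,\rho^{\alpha(s)}_{x_0}\,\mathcal T$ and $[f]_{\mathrm{st}\to y}=\int\mathcal D\hat x\,f\,\rho^{\alpha(s)}_{x_0}\,\delta_{x_n,y}\,\mathcal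 T$; the interval is $[-\tau,\tau]$ where none is indicated. The $\Psi$-modified expectation on $[-\tau,\tau]$ reweights the initial and the final quarter of the interval: $$\langle f\rangle^{\hat\alpha}_{\Psi\text{-mod}}=\frac{\bigl\langle f\,\exp[-(\Psi^{[-\tau,-\tau/2],(\alpha)}+\Psi^{[\tau/2,\tau],(\alpha')})/2]\bigr\rangle^{\hat\alpha}_{\mathrm{st}\to}}{\bigl\langle \exp[-(\Psi^{[-\tau,-\tau/2],(\alpha)}+\Psi^{[\tau/2,\tau],(\alpha')})/2]\bigr\rangle^{\hat\alpha}_{\mathrm{st}\to}}$$ (for $\hat\alpha^\dagger$ the roles of $\alpha$ and $\alpha'$ are exchanged). **Theorem.** There is a (necessarily unique) function $F$ of the parameters, the nonequilibrium free energy, such that for every $\alpha$ and every $x\in\mathcal S$ the following limit exists and $$e^{-\beta F(\alpha)}=e^{-\beta H^\nu_x}\lim_{\tau\uparrow\infty}\frac{\langle e^{-\Psi^{[-\tau,-\tau/2],(\alpha)}/2}\rangle^{[-\tau,-\tau/2],(\alpha)}_{x\to}}{[e^{-\Psi^{[\tau/2,\tau],(\alpha)}/2}]^{[\tau/2,\tau],(\alpha)}_{\mathrm{st}\to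 x}}.$$ For any protocol $\hat\alpha$, both limits below exist, are positive, and satisfy $$\lim_{\tau\uparrow\infty}\bigl\langle e^{-\beta W^{\hat\nu}}\bigr\rangle^{\hat\alpha}_{\mathrm{st}\to}=e^{-\beta\{F(\alpha')-F(\alpha)\}}\lim_{\tau\uparrow\infty}\bigl\langle\exp[-\Psi^{[-\tau/2,\tau/2],\hat\alpha^\dagger}]\bigr\rangle^{\hat\alpha^\dagger}_{\Psi\text{-mod}}.$$ -/

import Mathlib

open Filter Topology MeasureTheory

/-- The data of the model.  `S` is the state space, `A` the set of parameters `α`, and `N` the set of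
parameters `ν` of the Hamiltonian.  The diagonal values `rate α x x` are never used. -/
structure JumpSystem (S A N : Type*) where
  /-- the transition rate from `x` to `y` -/
  rate : A → S → S → ℝ
  rate_nonneg : ∀ α x y, x ≠ y → 0 ≤ rate α x y
  rate_ne_zero_symm : ∀ α x y, x ≠ y → rate α x y ≠ 0 → rate α y x ≠ 0
  connected : ∀ α x y, Relation.ReflTransGen (fun u v => u ≠ v ∧ rate α u v ≠ 0) x y
  /-- the component `ν` of `α` -/
  hamParam : A → N
  /-- the energy of the state `x` -/
  energy : N → S → ℝ
  /-- the reference inverse temperature -/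
  beta : ℝ
  beta_pos : 0 < beta

/-- A path, given by its number of jumps, the successive states, and the jump times. -/
structure JumpPath (S : Type*) where
  numJumps : ℕ
  state : Fin (numJumps + 1) → S
  jumpTime : Fin numJumps → ℝ

namespace JumpPath

variable {S : Type*}

/-- The times `t_0 = s, t_1, …, t_n, t_{n+1} = e` of a path on the time interval `[s, e]`. -/
noncomputable def time (s e : ℝ) (p : JumpPath S) : Fin (p.numJumps + 2) → ℝ :=
  Fin.cons s (Fin.snoc (α := fun _ => ℝ) p.jumpTime e)

/-- The initial state. -/
def first (p : JumpPath S) : S := p.state 0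

/-- The final state. -/
def last (p : JumpPath S) : S := p.state (Fin.last p.numJumps)

end JumpPath

/-- The ordered `n`-tuples of jump times in `(s, e)`. -/
def jumpTimes (s e : ℝ) (n : ℕ) : Set (Fin n → ℝ) :=
  {t | StrictMono t ∧ ∀ j, s < t j ∧ t j < e}

/-- The integral over all paths on the time interval `[s, e]`. -/
noncomputable def pathIntegral {S : Type*} [Fintype S] [DecidableEq S] (s e : ℝ)
    (f : JumpPath S → ℝ) : ℝ :=
  ∑' n : ℕ, ∑ x : Fin (n + 1) → S with ∀ j : Fin n, x j.castSucc ≠ x j.succ,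
    ∫ t in jumpTimes s e n, f ⟨n, x, t⟩

namespace JumpSystem

variable {S A N : Type*}

section Definitions

variable [Fintype S] [DecidableEq S] (M : JumpSystem S A N)

/-- The escape rate at `x`. -/
def escape (α : A) (x : S) : ℝ := ∑ y : S with y ≠ x, M.rate α x y

/-- `p` is a stationary probability distribution of the master equation with parameter `α`. -/
def IsStationary (α : A) (p : S → ℝ) : Prop :=
  (∀ x, 0 ≤ p x) ∧ ∑ x, p x = 1 ∧
    ∀ x, -M.escape α x * p x + ∑ y : S with y ≠ x, p y * M.rate α y x = 0

theorem exists_isStationary [Nonempty S] (α : A) : ∃ p, M.IsStationary α p := by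
  classical
  -- the rate matrix, and a nonzero vector in its kernel
  let Q : Matrix S S ℝ := fun x y => if y = x then -M.escape α x else M.rate α y x
  have hcol : ∀ y, ∑ x, Q x y = 0 := by
    intro y
    rw [← Finset.add_sum_erase _ _ (Finset.mem_univ y)]
    have h1 : ∑ x ∈ Finset.univ.erase y, Q x y = M.escape α y := by
      unfold escape
      refine Finset.sum_congr ?_ ?_
      · ext x; simp
      · intro x hx
        have hxy : y ≠ x := by
          intro h; simp [h] at hx
        simp [Q, hxy]
    rw [h1]; simp [Q]
  have hdet : Q.det = 0 := by
    rw [← Matrix.exists_vecMul_eq_zero_iff]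
    refine ⟨fun _ => 1, ?_, ?_⟩
    · intro h
      obtain ⟨x⟩ := ‹Nonempty S›
      simpa using congrFun h x
    · ext y
      simpa [Matrix.vecMul, dotProduct] using hcol y
  obtain ⟨v, hv0, hv⟩ := Matrix.exists_mulVec_eq_zero_iff.mpr hdet
  have hrow : ∀ w : S → ℝ, ∀ x, (Q.mulVec w) x =
      -M.escape α x * w x + ∑ y : S with y ≠ x, w y * M.rate α y x := by
    intro w x
    simp only [Matrix.mulVec, dotProduct]
    rw [← Finset.add_sum_erase _ _ (Finset.mem_univ x)]
    congr 1
    · simp [Q]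
    · refine Finset.sum_congr ?_ ?_
      · ext y; simp
      · intro y hy
        have hyx : y ≠ x := by
          intro h; simp [h] at hy
        simp [Q, hyx, mul_comm]
  have hesc : ∀ x, 0 ≤ M.escape α x := fun x =>
    Finset.sum_nonneg fun y hy => M.rate_nonneg α x y (by simp at hy; exact fun h => hy h.symm)
  -- its absolute value is in the kernel too
  have hnn : ∀ x, 0 ≤ (Q.mulVec fun y => |v y|) x := by
    intro x
    have h0 := congrFun hv x
    rw [hrow] at h0 ⊢
    have h1 : M.escape α x * v x = ∑ y : S with y ≠ x, v y * M.rate α y x := by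
      simp only [Pi.zero_apply] at h0; linarith
    have h2 : M.escape α x * |v x| ≤ ∑ y : S with y ≠ x, |v y| * M.rate α y x := by
      rw [← abs_of_nonneg (hesc x), ← abs_mul, h1]
      refine (Finset.abs_sum_le_sum_abs _ _).trans (Finset.sum_le_sum fun y hy => ?_)
      rw [abs_mul, abs_of_nonneg (M.rate_nonneg α y x (by simpa using hy))]
    linarith
  have hsum : ∑ x, (Q.mulVec fun y => |v y|) x = 0 := by
    simp only [Matrix.mulVec, dotProduct]
    rw [Finset.sum_comm]
    refine Finset.sum_eq_zero fun y _ => ?_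
    rw [← Finset.sum_mul, hcol, zero_mul]
  have hz := (Finset.sum_eq_zero_iff_of_nonneg fun x _ => hnn x).mp hsum
  have hpos : 0 < ∑ x, |v x| := by
    obtain ⟨x, hx⟩ := Function.ne_iff.mp hv0
    exact Finset.sum_pos' (fun y _ => abs_nonneg _) ⟨x, Finset.mem_univ x, abs_pos.mpr hx⟩
  refine ⟨fun x => |v x| / ∑ y, |v y|, fun x => by positivity, ?_, fun x => ?_⟩
  · rw [← Finset.sum_div, div_self hpos.ne']
  · have h := hz x (Finset.mem_univ x)
    rw [hrow] at h
    have h3 : ∑ y : S with y ≠ x, |v y| / (∑ z, |v z|) * M.rate α y x =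
        (∑ y : S with y ≠ x, |v y| * M.rate α y x) / ∑ z, |v z| := by
      rw [Finset.sum_div]
      exact Finset.sum_congr rfl fun y _ => by ring
    rw [h3, mul_div_assoc', ← add_div, h, zero_div]

/-- The stationary distribution `ρ` for the parameter `α` (it is unique by connectedness). -/
noncomputable def steady [Nonempty S] (α : A) : S → ℝ :=
  Classical.choose (M.exists_isStationary α)

/-- The entropy production in the transition from `x` to `y`. -/
noncomputable def theta (α : A) (x y : S) : ℝ := Real.log (M.rate α x y / M.rate α y x)

/-- The nonequilibrium part of the entropy production in the transition from `x` to `y`. -/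
noncomputable def psi (α : A) (x y : S) : ℝ :=
  M.theta α x y - M.beta * (M.energy (M.hamParam α) x - M.energy (M.hamParam α) y)

/-- The nonequilibrium part of the entropy production in the time interval `[c, d]` for a path `p`,
under the protocol `a`. -/
noncomputable def psiOn (c d : ℝ) (a : ℝ → A) (p : JumpPath S) : ℝ :=
  ∑ j : Fin p.numJumps, (Set.Icc c d).indicator
    (fun t => M.psi (a t) (p.state j.castSucc) (p.state j.succ)) (p.jumpTime j)

/-- The work done in a path on `[s, e]` under the protocol `a`. -/
noncomputable def work (s e : ℝ) (a : ℝ → A) (p : JumpPath S) : ℝ :=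
  ∑ j : Fin (p.numJumps + 1),
    (M.energy (M.hamParam (a (p.time s e j.succ))) (p.state j) -
      M.energy (M.hamParam (a (p.time s e j.castSucc))) (p.state j))

/-- The weight (transition probability density) of a path on `[s, e]` under the protocol `a`. -/
noncomputable def weight (s e : ℝ) (a : ℝ → A) (p : JumpPath S) : ℝ :=
  (∏ j : Fin p.numJumps,
      M.rate (a (p.jumpTime j)) (p.state j.castSucc) (p.state j.succ)) *
    ∏ j : Fin (p.numJumps + 1),
      Real.exp (-∫ t in (p.time s e j.castSucc)..(p.time s e j.succ), M.escape (a t) (p.state j))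

/-- The expectation of `f` on `[s, e]` for the system that starts from the state `x`. -/
noncomputable def expectFrom (s e : ℝ) (a : ℝ → A) (x : S) (f : JumpPath S → ℝ) : ℝ :=
  pathIntegral s e fun p => f p * (if p.first = x then 1 else 0) * M.weight s e a p

variable [Nonempty S]

/-- The expectation of `f` on `[s, e]` for the system that starts from the steady state. -/
noncomputable def expectSt (s e : ℝ) (a : ℝ → A) (f : JumpPath S → ℝ) : ℝ :=
  pathIntegral s e fun p => f p * M.steady (a s) p.first * M.weight s e a p

/-- The unnormalized expectation of `f` on `[s, e]` for the system that starts from the steady state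
and ends in the state `y`. -/
noncomputable def expectStTo (s e : ℝ) (a : ℝ → A) (y : S) (f : JumpPath S → ℝ) : ℝ :=
  pathIntegral s e fun p =>
    f p * M.steady (a s) p.first * (if p.last = y then 1 else 0) * M.weight s e a p

/-- The weight that the modified expectation on `[-τ, τ]` gives to the initial and the final quarter
of the time interval; the protocol is constant there. -/
noncomputable def quarterWeight (τ : ℝ) (a : ℝ → A) (p : JumpPath S) : ℝ :=
  Real.exp (-(M.psiOn (-τ) (-τ / 2) (fun _ => a (-τ)) p +
    M.psiOn (τ / 2) τ (fun _ => a τ) p) / 2)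

/-- The `Ψ`-modified expectation of `f` on `[-τ, τ]`. -/
noncomputable def expectPsiMod (τ : ℝ) (a : ℝ → A) (f : JumpPath S → ℝ) : ℝ :=
  M.expectSt (-τ) τ a (fun p => f p * M.quarterWeight τ a p) /
    M.expectSt (-τ) τ a (fun p => M.quarterWeight τ a p)

/-- `F` is the nonequilibrium free energy: `exp (-β F(α))` is the limit below, for every state `x`
(so the limit exists and does not depend on `x`).  This determines `F`. -/
def IsFreeEnergy (F : A → ℝ) : Prop :=
  ∀ (α : A) (x : S), Tendsto
    (fun τ : ℝ => Real.exp (-M.beta * M.energy (M.hamParam α) x) *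
      (M.expectFrom (-τ) (-τ / 2) (fun _ => α) x
          (fun p => Real.exp (-M.psiOn (-τ) (-τ / 2) (fun _ => α) p / 2)) /
        M.expectStTo (τ / 2) τ (fun _ => α) x
          (fun p => Real.exp (-M.psiOn (τ / 2) τ (fun _ => α) p / 2))))
    atTop (𝓝 (Real.exp (-M.beta * F α)))

end Definitions

/-- `a` is a protocol that is operated during `[-τo, τo]` and is constant before and after.  It need
not be continuous; the rates and the energies along it are measurable and bounded functions of time,
as they are for a measurable protocol in a compact set on which they are continuous. -/
structure IsProtocol (M : JumpSystem S A N) (τo : ℝ) (a : ℝ → A) : Prop where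
  eq_initial : ∀ t, t ≤ -τo → a t = a (-τo)
  eq_final : ∀ t, τo ≤ t → a t = a τo
  measurable_rate : ∀ x y, x ≠ y → Measurable fun t => M.rate (a t) x y
  measurable_energy : ∀ x, Measurable fun t => M.energy (M.hamParam (a t)) x
  bounded_rate : ∀ x y, x ≠ y → ∃ C, ∀ t, M.rate (a t) x y ≤ C
  bounded_energy : ∀ x, ∃ C, ∀ t, |M.energy (M.hamParam (a t)) x| ≤ C

end JumpSystem

/-- The time-reversed protocol. -/
def reverseProtocol {A : Type*} (a : ℝ → A) : ℝ → A := fun t => a (-t)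

/-! An expectation of a product of factors g over the jumps is a matrix element of the propagator of
W' = W K, where K has diagonal −λ and off-diagonal entries R g (`pathIntegral_mul_weight`).
Summation by parts along a path writes e^{-βW} as boundary factors e^{βH} and e^{-βH} times the
factors e^{β(H_y - H_x)} of the jumps, so the work is governed by `workMatrix`. By the definition of
ψ, the transpose of this matrix has the off-diagonal entries R_{x→y} e^{-ψ_{x→y}}. Time reversal
transposes a propagator (`propagator_reverse`); hence the weight e^{-Ψ} under the reversed protocol
has the transposed work propagator.

At constant α the work matrix has the right null vector e^{-βH} and the left null vector ρ e^{βH}.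
So the expectation of e^{-βW} is a constant c > 0 as soon as τ ≥ τo, and the work propagator over
[-τ/2, τ/2] tends to c u wᵀ with u = e^{-βH} at α and w = ρ e^{βH} at α'
(`tendsto_propagator_workMatrix`).

In the first and last quarters the entries are R_{x→y} e^{-ψ/2} = e^{βH_x/2} √(R_{x→y} R_{y→x})
e^{-βH_y/2}: the generator is conjugate to a symmetric matrix. If v is the Perron–Frobenius vector
of the latter, the leading right and left eigenvectors are r = e^{βH/2} v and l = e^{-βH/2} v
(`exists_halfMatrix_asymptotics`). The relation e^{-βH} r = l makes the limit defining F independent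
of x and gives e^{-βF} = (l·1)/(ρ·r) (`tendsto_free_energy`).

With primes for α', the numerator of the modified expectation behaves like c
(ρ'·r')(l'·w)(u·r)(l·1). In the denominator the middle propagator tends to 1 ρᵀ, which gives
(ρ'·r')(l'·1)(ρ·r)(l·1) with the same exponential growth factors. Since l'·w = ρ'·r' and u·r = l·1,
the quotient is c e^{-βF(α)} / e^{-βF(α')}, which is the assertion. -/

/-! ### Calculus for primitives of functions that are merely measurable. -/

/-- Integration by parts for two functions given as primitives of integrable functions. -/
theorem primitive_mul_primitive {f g : ℝ → ℝ} {s e : ℝ} (hf : IntervalIntegrable f volume s e)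
    (hg : IntervalIntegrable g volume s e) (a b : ℝ) :
    (a + ∫ u in s..e, f u) * (b + ∫ u in s..e, g u) =
      a * b + ∫ t in s..e,
        (f t * (b + ∫ u in s..t, g u) + (a + ∫ u in s..t, f u) * g t) := by
  have ac : ∀ {h : ℝ → ℝ} (_ : IntervalIntegrable h volume s e) (c : ℝ),
      AbsolutelyContinuousOnInterval (fun t => c + ∫ u in s..t, h u) s e := by
    intro h hh c
    have h1 : AbsolutelyContinuousOnInterval (fun _ : ℝ => c) s e :=
      (LipschitzWith.const c).lipschitzOnWith.absolutelyContinuousOnInterval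
    exact h1.fun_add (hh.absolutelyContinuousOnInterval_intervalIntegral Set.left_mem_uIcc)
  have hd : ∀ {h : ℝ → ℝ} (_ : IntervalIntegrable h volume s e) (c : ℝ),
      ∀ᵐ t, t ∈ Set.uIcc s e → HasDerivAt (fun t => c + ∫ u in s..t, h u) (h t) t := by
    intro h hh c
    filter_upwards [hh.ae_hasDerivAt_integral] with t ht hts
    exact (ht hts s Set.left_mem_uIcc).const_add c
  have key := (ac hf a).integral_deriv_mul_eq_sub (ac hg b)
  simp only [intervalIntegral.integral_same, add_zero] at key
  rw [← sub_eq_iff_eq_add', ← key]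
  refine intervalIntegral.integral_congr_ae ?_
  filter_upwards [hd hf a, hd hg b] with t h1 h2 ht
  rw [(h1 (Set.uIoc_subset_uIcc ht)).deriv, (h2 (Set.uIoc_subset_uIcc ht)).deriv]

/-- The exponential of the primitive of a bounded measurable function. -/
theorem exp_neg_primitive {l : ℝ → ℝ} {s e C : ℝ} (hse : s ≤ e) (hl : Measurable l)
    (hC : ∀ t ∈ Set.Icc s e, |l t| ≤ C) :
    Real.exp (-∫ u in s..e, l u) =
      1 + ∫ t in s..e, -(l t * Real.exp (-∫ u in s..t, l u)) := by
  have hint : IntervalIntegrable l volume s e := by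
    rw [intervalIntegrable_iff_integrableOn_Icc_of_le hse]
    exact Measure.integrableOn_of_bounded (M := C) (by simp) hl.aestronglyMeasurable
      ((ae_restrict_iff' measurableSet_Icc).2 (Eventually.of_forall hC))
  have hC0 : 0 ≤ C := (abs_nonneg _).trans (hC s (Set.left_mem_Icc.2 hse))
  -- A bounded integrand makes the primitive Lipschitz, and exp is Lipschitz on the compact range of
  -- the primitive. The composite is therefore absolutely continuous and is the integral of its
  -- almost everywhere derivative.
  have hlip : LipschitzOnWith C.toNNReal (fun t => -∫ u in s..t, l u) (Set.uIcc s e) := by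
    rw [Set.uIcc_of_le hse]
    refine LipschitzOnWith.of_dist_le_mul fun t ht t' ht' => ?_
    have h1 : ∀ v ∈ Set.Icc s e, IntervalIntegrable l volume s v := fun v hv =>
      hint.mono_set (by
        rw [Set.uIcc_of_le hse, Set.uIcc_of_le hv.1]; exact Set.Icc_subset_Icc le_rfl hv.2)
    rw [Real.coe_toNNReal _ hC0, dist_neg_neg, dist_comm, Real.dist_eq,
      intervalIntegral.integral_interval_sub_left (h1 _ ht') (h1 _ ht), dist_comm, Real.dist_eq]
    refine intervalIntegral.norm_integral_le_of_norm_le_const (C := C) (f := l) fun u hu => hC u ?_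
    have := Set.uIoc_subset_uIcc hu
    exact Set.uIcc_subset_Icc ht ht' this
  obtain ⟨M, hM⟩ : ∃ M, ∀ t ∈ Set.uIcc s e, |-∫ u in s..t, l u| ≤ M :=
    (isCompact_uIcc.exists_bound_of_continuousOn hlip.continuousOn)
  obtain ⟨K', hK'⟩ := (Real.contDiff_exp (n := 1)).contDiffOn.exists_lipschitzOnWith
    (s := Set.Icc (-M) M) (by decide) (convex_Icc _ _) isCompact_Icc
  have hac := (hK'.comp hlip fun t ht => abs_le.1 (hM t ht)).absolutelyContinuousOnInterval
  have key := hac.integral_deriv_eq_sub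
  simp only [Function.comp, intervalIntegral.integral_same, neg_zero, Real.exp_zero] at key
  rw [← sub_eq_iff_eq_add', ← key]
  refine intervalIntegral.integral_congr_ae ?_
  filter_upwards [hint.ae_hasDerivAt_integral] with t ht hts
  have := ((ht (Set.uIoc_subset_uIcc hts) s Set.left_mem_uIcc).neg).exp
  exact this.deriv.trans (by simp only [Pi.neg_apply]; ring)

theorem intervalIntegrable_finset_sum {ι : Type*} [Fintype ι] {f : ι → ℝ → ℝ} {s e : ℝ}
    (hf : ∀ i, IntervalIntegrable (f i) volume s e) :
    IntervalIntegrable (fun t => ∑ i, f i t) volume s e := by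
  simpa only [← Finset.sum_fn] using IntervalIntegrable.sum Finset.univ fun i _ => hf i

/-! ### The Dyson series, and forward and backward matrix equations in integrated form. -/

section Propagator

variable {S : Type*}

/-- A time-dependent matrix with measurable entries that are bounded on bounded intervals. -/
structure IsLocBddMatrix (K : ℝ → Matrix S S ℝ) : Prop where
  measurable : ∀ x y, Measurable fun t => K t x y
  bounded : ∀ s e, ∃ C, ∀ t ∈ Set.Icc s e, ∀ x y, |K t x y| ≤ C

variable {K : ℝ → Matrix S S ℝ} {s e : ℝ}

theorem IsLocBddMatrix.intervalIntegrable (hK : IsLocBddMatrix K) (s e : ℝ) (x y : S) :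
    IntervalIntegrable (fun t => K t x y) volume s e := by
  rw [intervalIntegrable_iff]
  obtain ⟨C, hC⟩ := hK.bounded (min s e) (max s e)
  exact Measure.integrableOn_of_bounded (M := C) (by simp [Set.uIoc])
    (hK.measurable x y).aestronglyMeasurable
    ((ae_restrict_iff' measurableSet_uIoc).2
      (Eventually.of_forall fun t ht => hC t (Set.uIoc_subset_uIcc ht) x y))

variable [Fintype S]

theorem IsLocBddMatrix.intervalIntegrable_mul (hK : IsLocBddMatrix K) {W : ℝ → Matrix S S ℝ}
    (hse : s ≤ e) (hW : ∀ x y, ContinuousOn (fun t => W t x y) (Set.Icc s e)) (x y : S) :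
    IntervalIntegrable (fun t => (W t * K t) x y) volume s e := by
  simp only [Matrix.mul_apply]
  refine intervalIntegrable_finset_sum fun z => ?_
  exact (hK.intervalIntegrable s e z y).continuousOn_mul (by rw [Set.uIcc_of_le hse]; exact hW x z)

theorem IsLocBddMatrix.intervalIntegrable_mul' (hK : IsLocBddMatrix K) {V : ℝ → Matrix S S ℝ}
    (hse : s ≤ e) (hV : ∀ x y, ContinuousOn (fun t => V t x y) (Set.Icc s e)) (x y : S) :
    IntervalIntegrable (fun t => (K t * V t) x y) volume s e := by
  simp only [Matrix.mul_apply]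
  refine intervalIntegrable_finset_sum fun z => ?_
  exact (hK.intervalIntegrable s e x z).mul_continuousOn (by rw [Set.uIcc_of_le hse]; exact hV z y)

variable [DecidableEq S]

/-- The `n`-th term of the Dyson series. -/
noncomputable def dysonTerm (K : ℝ → Matrix S S ℝ) (s : ℝ) : ℕ → ℝ → Matrix S S ℝ
  | 0, _ => 1
  | n + 1, e => Matrix.of fun x y => ∫ u in s..e, (dysonTerm K s n u * K u) x y

/-- The propagator of the equation `W' = W K`, as the sum of the Dyson series. -/
noncomputable def propagator (K : ℝ → Matrix S S ℝ) (s e : ℝ) : Matrix S S ℝ :=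
  Matrix.of fun x y => ∑' n, dysonTerm K s n e x y

/-- `W` solves `W' = W K` on `[s, e]`, in integrated form. -/
structure IsForward (K : ℝ → Matrix S S ℝ) (s e : ℝ) (W : ℝ → Matrix S S ℝ) : Prop where
  continuousOn : ∀ x y, ContinuousOn (fun t => W t x y) (Set.Icc s e)
  eq : ∀ t ∈ Set.Icc s e, ∀ x y, W t x y = W s x y + ∫ u in s..t, (W u * K u) x y

/-- `V` solves `V' = - K V` on `[s, e]`, in integrated form. -/
structure IsBackward (K : ℝ → Matrix S S ℝ) (s e : ℝ) (V : ℝ → Matrix S S ℝ) : Prop where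
  continuousOn : ∀ x y, ContinuousOn (fun t => V t x y) (Set.Icc s e)
  eq : ∀ t ∈ Set.Icc s e, ∀ x y, V t x y = V s x y + ∫ u in s..t, -(K u * V u) x y

theorem dysonTerm_continuousOn (hK : IsLocBddMatrix K) (hse : s ≤ e) (n : ℕ) (x y : S) :
    ContinuousOn (fun t => dysonTerm K s n t x y) (Set.Icc s e) := by
  induction n generalizing x y with
  | zero => exact continuousOn_const
  | succ n ih =>
    have := intervalIntegral.continuousOn_primitive_interval'
      (hK.intervalIntegrable_mul hse ih x y) (a := s) Set.left_mem_uIcc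
    rwa [Set.uIcc_of_le hse] at this

/-- Each matrix product costs a factor |S|, and the integration over ordered times gives 1/n!, so
the series converges on intervals of any length. -/
theorem abs_dysonTerm_le {C : ℝ}
    (hC : ∀ t ∈ Set.Icc s e, ∀ x y, |K t x y| ≤ C) (n : ℕ) {t : ℝ} (ht : t ∈ Set.Icc s e)
    (x y : S) :
    |dysonTerm K s n t x y| ≤ (Fintype.card S * C * (t - s)) ^ n / n.factorial := by
  induction n generalizing t x y with
  | zero =>
    simp only [dysonTerm, Matrix.one_apply, pow_zero, Nat.factorial_zero, Nat.cast_one, div_one]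
    split_ifs <;> simp
  | succ n ih =>
    have hC0 : 0 ≤ C := (abs_nonneg _).trans (hC t ht x y)
    simp only [dysonTerm, Matrix.of_apply]
    have hb : ∀ u ∈ Set.uIoc s t, ‖(dysonTerm K s n u * K u) x y‖ ≤
        Fintype.card S * C * ((Fintype.card S * C) ^ n / n.factorial * (u - s) ^ n) := by
      intro u hu
      rw [Set.uIoc_of_le ht.1] at hu
      have hu' : u ∈ Set.Icc s e := ⟨hu.1.le, hu.2.trans ht.2⟩
      rw [Matrix.mul_apply]
      calc ‖∑ z, dysonTerm K s n u x z * K u z y‖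
          ≤ ∑ z : S, ((Fintype.card S * C * (u - s)) ^ n / n.factorial) * C := by
            refine (norm_sum_le _ _).trans (Finset.sum_le_sum fun z _ => ?_)
            rw [Real.norm_eq_abs, abs_mul]
            exact mul_le_mul (ih hu' x z) (hC u hu' z y) (abs_nonneg _)
              ((abs_nonneg _).trans (ih hu' x z))
        _ = _ := by
            rw [Finset.sum_const, Finset.card_univ, nsmul_eq_mul, mul_pow _ (u - s)]; ring
    have h2 := intervalIntegral.norm_integral_le_abs_of_norm_le
      (g := fun u => Fintype.card S * C * ((Fintype.card S * C) ^ n / n.factorial * (u - s) ^ n))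
      (f := fun u => (dysonTerm K s n u * K u) x y) (a := s) (b := t) (μ := volume)
      ((ae_restrict_iff' measurableSet_uIoc).2 (Eventually.of_forall hb))
      (Continuous.intervalIntegrable (by fun_prop) _ _)
    rw [← Real.norm_eq_abs]
    refine h2.trans (le_of_eq ?_)
    rw [intervalIntegral.integral_const_mul, intervalIntegral.integral_const_mul,
      intervalIntegral.integral_comp_sub_right (fun u => u ^ n), integral_pow]
    have hts : 0 ≤ t - s := sub_nonneg.2 ht.1
    rw [abs_of_nonneg (by simp; positivity), Nat.factorial_succ]
    push_cast
    field_simp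
    simp only [sub_self, mul_pow]
    ring_nf

theorem exists_dysonTerm_bound (hK : IsLocBddMatrix K) (s e : ℝ) :
    ∃ b : ℕ → ℝ, Summable b ∧ ∀ n, ∀ t ∈ Set.Icc s e, ∀ x y, |dysonTerm K s n t x y| ≤ b n := by
  obtain ⟨C, hC⟩ := hK.bounded s e
  have hC' : ∀ t ∈ Set.Icc s e, ∀ x y, |K t x y| ≤ |C| := fun t ht x y =>
    (hC t ht x y).trans (le_abs_self C)
  refine ⟨fun n => (Fintype.card S * |C| * (e - s)) ^ n / n.factorial,
    Real.summable_pow_div_factorial _, fun n t ht x y => ?_⟩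
  refine (abs_dysonTerm_le hC' n ht x y).trans ?_
  have h1 : 0 ≤ t - s := sub_nonneg.2 ht.1
  have h2 : t - s ≤ e - s := sub_le_sub_right ht.2 s
  simp only
  gcongr

theorem hasSum_dysonTerm (hK : IsLocBddMatrix K) (hse : s ≤ e) (x y : S) :
    HasSum (fun n => dysonTerm K s n e x y) (propagator K s e x y) := by
  obtain ⟨b, hb, h⟩ := exists_dysonTerm_bound hK s e
  exact (Summable.of_norm_bounded hb fun n => h n e (Set.right_mem_Icc.2 hse) x y).hasSum

theorem propagator_self (hK : IsLocBddMatrix K) (s : ℝ) : propagator K s s = 1 := by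
  ext x y
  refine (hasSum_dysonTerm hK le_rfl x y).unique (hasSum_single 0 fun n hn => ?_)
  obtain ⟨m, rfl⟩ := Nat.exists_eq_succ_of_ne_zero hn
  simp [dysonTerm]

theorem propagator_isForward (hK : IsLocBddMatrix K) (hse : s ≤ e) :
    IsForward K s e (propagator K s) := by
  obtain ⟨b, hb, h⟩ := exists_dysonTerm_bound hK s e
  obtain ⟨C, hC⟩ := hK.bounded s e
  have hself : ∀ x y, propagator K s s x y = (1 : Matrix S S ℝ) x y := by
    intro x y
    rw [propagator_self hK]
  refine ⟨fun x y => ?_, fun t ht x y => ?_⟩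
  · exact continuousOn_tsum (fun n => dysonTerm_continuousOn hK hse n x y) hb
      fun n t ht => h n t ht x y
  · have h1 : HasSum (fun n => ∫ u in s..t, (dysonTerm K s n u * K u) x y)
        (∫ u in s..t, (propagator K s u * K u) x y) := by
      have hmem : ∀ u ∈ Set.uIoc s t, u ∈ Set.Icc s e := fun u hu => by
        rw [Set.uIoc_of_le ht.1] at hu
        exact ⟨hu.1.le, hu.2.trans ht.2⟩
      have hsub : ∀ {W : ℝ → Matrix S S ℝ},
          (∀ x y, ContinuousOn (fun t => W t x y) (Set.Icc s e)) →
          ∀ x y, ContinuousOn (fun t => W t x y) (Set.Icc s t) := fun hW x y =>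
        (hW x y).mono (Set.Icc_subset_Icc le_rfl ht.2)
      refine intervalIntegral.hasSum_integral_of_dominated_convergence
        (fun n _ => ∑ _z : S, b n * C) (fun n => ?_) (fun n => ?_) ?_ ?_ ?_
      · exact (hK.intervalIntegrable_mul ht.1
          (hsub (dysonTerm_continuousOn hK hse n)) x y).aestronglyMeasurable_restrict_uIoc
      · refine Eventually.of_forall fun u hu => ?_
        rw [Matrix.mul_apply]
        refine (norm_sum_le _ _).trans (Finset.sum_le_sum fun z _ => ?_)
        rw [Real.norm_eq_abs, abs_mul]
        exact mul_le_mul (h n u (hmem u hu) x z) (hC u (hmem u hu) z y) (abs_nonneg _)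
          ((abs_nonneg _).trans (h n u (hmem u hu) x z))
      · exact Eventually.of_forall fun u _ => summable_sum fun z _ => hb.mul_right C
      · exact intervalIntegrable_const
      · refine Eventually.of_forall fun u hu => ?_
        simp only [Matrix.mul_apply]
        exact hasSum_sum fun z _ => (hasSum_dysonTerm hK (hmem u hu).1 x z).mul_right _
    have h2 := (hasSum_nat_add_iff' 1).2 (hasSum_dysonTerm hK ht.1 x y)
    have h3 := h1.unique h2
    rw [h3, hself]
    simp [dysonTerm]

omit [DecidableEq S] in
/-- Forward and backward solutions are dual. -/
theorem IsForward.mul_isBackward (hK : IsLocBddMatrix K) {W V : ℝ → Matrix S S ℝ}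
    (hW : IsForward K s e W) (hV : IsBackward K s e V) (hse : s ≤ e) :
    W e * V e = W s * V s := by
  have hWi := hK.intervalIntegrable_mul hse hW.continuousOn
  have hVi : ∀ x y, IntervalIntegrable (fun t => -(K t * V t) x y) volume s e := fun x y =>
    (hK.intervalIntegrable_mul' hse hV.continuousOn x y).neg
  have he := Set.right_mem_Icc.2 hse
  ext x y
  have hz : ∀ z, W e x z * V e z y = W s x z * V s z y +
      ∫ t in s..e, ((W t * K t) x z * V t z y + W t x z * -(K t * V t) z y) := by
    intro z
    rw [hW.eq e he, hV.eq e he, primitive_mul_primitive (hWi x z) (hVi z y)]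
    congr 1
    refine intervalIntegral.integral_congr fun t ht => ?_
    rw [Set.uIcc_of_le hse] at ht
    rw [← hW.eq t ht, ← hV.eq t ht]
  rw [Matrix.mul_apply, Matrix.mul_apply, Finset.sum_congr rfl fun z _ => hz z,
    Finset.sum_add_distrib, ← intervalIntegral.integral_finsetSum]
  · rw [add_eq_left]
    refine intervalIntegral.integral_zero_ae (Eventually.of_forall fun t _ => ?_)
    -- The derivative of W V is (W K) V − W (K V), which vanishes by associativity.
    have := congrFun (congrFun (Matrix.mul_assoc (W t) (K t) (V t)) x) y
    rw [Matrix.mul_apply, Matrix.mul_apply] at this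
    simp only [mul_neg, Finset.sum_add_distrib, Finset.sum_neg_distrib]
    rw [this]
    ring
  · intro z _
    refine IntervalIntegrable.add ?_ ?_
    · exact (hWi x z).mul_continuousOn (by rw [Set.uIcc_of_le hse]; exact hV.continuousOn z y)
    · exact (hVi z y).continuousOn_mul (by rw [Set.uIcc_of_le hse]; exact hW.continuousOn x z)

end Propagator

/-! ### Reversal, uniqueness, composition, gauge transformation and positivity of propagators. -/

section PropagatorTheory

variable {S : Type*} [Fintype S] [DecidableEq S] {K : ℝ → Matrix S S ℝ} {s e : ℝ}

/-- The time-reversed transposed matrix. -/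
def reverseMatrix {S : Type*} (K : ℝ → Matrix S S ℝ) : ℝ → Matrix S S ℝ := fun t => (K (-t)).transpose

theorem IsLocBddMatrix.reverse {S : Type*} {K : ℝ → Matrix S S ℝ} (hK : IsLocBddMatrix K) :
    IsLocBddMatrix (reverseMatrix K) := by
  refine ⟨fun x y => (hK.measurable y x).comp measurable_neg, fun s e => ?_⟩
  obtain ⟨C, hC⟩ := hK.bounded (-e) (-s)
  exact ⟨C, fun t ht x y => hC (-t) ⟨neg_le_neg ht.2, neg_le_neg ht.1⟩ y x⟩

omit [DecidableEq S] in
theorem IsForward.mono {W : ℝ → Matrix S S ℝ} (hW : IsForward K s e W) {m : ℝ} (hm : m ≤ e) :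
    IsForward K s m W :=
  ⟨fun x y => (hW.continuousOn x y).mono (Set.Icc_subset_Icc le_rfl hm),
    fun t ht => hW.eq t ⟨ht.1, ht.2.trans hm⟩⟩

/-- This is the backward solution with value 1 at the final time e. Pairing it with forward
solutions by duality yields both the reversal formula and uniqueness. -/
theorem reverse_propagator_isBackward (hK : IsLocBddMatrix K) (hse : s ≤ e) :
    IsBackward K s e (fun t => (propagator (reverseMatrix K) (-e) (-t)).transpose) := by
  have hP := propagator_isForward hK.reverse (neg_le_neg hse)
  have hmaps : Set.MapsTo (fun t : ℝ => -t) (Set.Icc s e) (Set.Icc (-e) (-s)) := fun t ht =>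
    ⟨neg_le_neg ht.2, neg_le_neg ht.1⟩
  have hcont : ∀ x y, ContinuousOn
      (fun t => (propagator (reverseMatrix K) (-e) (-t)).transpose x y) (Set.Icc s e) := fun x y =>
    (hP.continuousOn y x).comp continuous_neg.continuousOn hmaps
  refine ⟨hcont, fun t ht x y => ?_⟩
  have hV : ∀ t ∈ Set.Icc s e, (propagator (reverseMatrix K) (-e) (-t)).transpose x y =
      (1 : Matrix S S ℝ) y x +
        ∫ u in t..e, (K u * (propagator (reverseMatrix K) (-e) (-u)).transpose) x y := by
    intro t ht
    rw [Matrix.transpose_apply, hP.eq (-t) (hmaps ht) y x, propagator_self hK.reverse,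
      ← intervalIntegral.integral_comp_neg]
    congr 1
    refine intervalIntegral.integral_congr fun u _ => ?_
    simp only [reverseMatrix, Matrix.mul_apply, Matrix.transpose_apply, neg_neg]
    exact Finset.sum_congr rfl fun z _ => mul_comm _ _
  have hint := hK.intervalIntegrable_mul' hse hcont x y
  have h1 := hint.mono_set (c := s) (d := t) (by
    rw [Set.uIcc_of_le hse, Set.uIcc_of_le ht.1]; exact Set.Icc_subset_Icc le_rfl ht.2)
  have h2 := hint.mono_set (c := t) (d := e) (by
    rw [Set.uIcc_of_le hse, Set.uIcc_of_le ht.2]; exact Set.Icc_subset_Icc ht.1 le_rfl)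
  rw [hV t ht, hV s (Set.left_mem_Icc.2 hse), ← intervalIntegral.integral_add_adjacent_intervals h1 h2,
    intervalIntegral.integral_neg]
  ring

/-- Time reversal of the propagator. -/
theorem propagator_reverse (hK : IsLocBddMatrix K) (hse : s ≤ e) :
    propagator (reverseMatrix K) (-e) (-s) = (propagator K s e).transpose := by
  have h := (propagator_isForward hK hse).mul_isBackward hK
    (reverse_propagator_isBackward hK hse) hse
  rw [propagator_self hK.reverse, propagator_self hK, Matrix.transpose_one, Matrix.mul_one,
    Matrix.one_mul] at h
  rw [h, Matrix.transpose_transpose]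

/-- Uniqueness for the forward equation. Composition, dependence on the interior of the interval
only, the exponential formula and the gauge transformation all follow by exhibiting a forward
solution. -/
theorem IsForward.eq_mul_propagator (hK : IsLocBddMatrix K) {W : ℝ → Matrix S S ℝ} (hse : s ≤ e)
    (hW : IsForward K s e W) : W e = W s * propagator K s e := by
  have h := hW.mul_isBackward hK (reverse_propagator_isBackward hK hse) hse
  rwa [propagator_self hK.reverse, propagator_reverse hK hse, Matrix.transpose_one,
    Matrix.mul_one, Matrix.transpose_transpose] at h

theorem propagator_mul_propagator (hK : IsLocBddMatrix K) {m : ℝ} (hsm : s ≤ m) (hme : m ≤ e) :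
    propagator K s m * propagator K m e = propagator K s e := by
  have hse := hsm.trans hme
  have hF := propagator_isForward hK hse
  refine (IsForward.eq_mul_propagator hK hme (W := propagator K s) ⟨fun x y =>
    (hF.continuousOn x y).mono (Set.Icc_subset_Icc hsm le_rfl), fun t ht x y => ?_⟩).symm
  have ht' : t ∈ Set.Icc s e := ⟨hsm.trans ht.1, ht.2⟩
  have hint := hK.intervalIntegrable_mul hse hF.continuousOn x y
  have h1 := hint.mono_set (c := s) (d := m) (by
    rw [Set.uIcc_of_le hse, Set.uIcc_of_le hsm]; exact Set.Icc_subset_Icc le_rfl hme)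
  have h2 := hint.mono_set (c := m) (d := t) (by
    rw [Set.uIcc_of_le hse, Set.uIcc_of_le ht.1]; exact Set.Icc_subset_Icc hsm ht.2)
  rw [hF.eq t ht', hF.eq m ⟨hsm, hme⟩,
    ← intervalIntegral.integral_add_adjacent_intervals h1 h2, add_assoc]

/-- Only the open interval matters, since endpoints are null sets. This disposes of the times ±τ/2,
where the closed intervals carrying the Ψ-factors overlap. -/
theorem propagator_congr {K' : ℝ → Matrix S S ℝ} (hK : IsLocBddMatrix K) (hK' : IsLocBddMatrix K')
    (hse : s ≤ e) (h : ∀ t ∈ Set.Ioo s e, K t = K' t) : propagator K s e = propagator K' s e := by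
  have hF := propagator_isForward hK hse
  have := IsForward.eq_mul_propagator hK' hse (W := propagator K s)
    ⟨hF.continuousOn, fun t ht x y => ?_⟩
  · rwa [propagator_self hK, Matrix.one_mul] at this
  · rw [hF.eq t ht]
    congr 1
    rw [intervalIntegral.integral_of_le ht.1, intervalIntegral.integral_of_le ht.1,
      integral_Ioc_eq_integral_Ioo, integral_Ioc_eq_integral_Ioo]
    refine setIntegral_congr_fun measurableSet_Ioo fun u hu => ?_
    simp only [h u ⟨hu.1, hu.2.trans_le ht.2⟩]

omit [DecidableEq S] in
theorem isLocBddMatrix_const (Q : Matrix S S ℝ) : IsLocBddMatrix fun _ : ℝ => Q :=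
  ⟨fun _ _ => measurable_const, fun _ _ =>
    ⟨∑ x, ∑ y, |Q x y|, fun _ _ x y =>
      (Finset.single_le_sum (f := fun y => |Q x y|) (fun _ _ => abs_nonneg _)
        (Finset.mem_univ y)).trans
      (Finset.single_le_sum (f := fun x => ∑ y, |Q x y|)
        (fun _ _ => Finset.sum_nonneg fun _ _ => abs_nonneg _) (Finset.mem_univ x))⟩⟩

open scoped Matrix.Norms.Operator in
theorem hasDerivAt_exp_smul_apply (Q : Matrix S S ℝ) (t : ℝ) (x y : S) :
    HasDerivAt (fun t : ℝ => NormedSpace.exp (t • Q) x y)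
      ((NormedSpace.exp (t • Q) * Q) x y) t := by
  have h := hasDerivAt_exp_smul_const Q t
  exact hasDerivAt_pi.1 (hasDerivAt_pi.1 h x) y

theorem propagator_const (Q : Matrix S S ℝ) (hse : s ≤ e) :
    propagator (fun _ => Q) s e = NormedSpace.exp ((e - s) • Q) := by
  have hd : ∀ (x y : S) (t : ℝ), HasDerivAt (fun t : ℝ => NormedSpace.exp ((t - s) • Q) x y)
      ((NormedSpace.exp ((t - s) • Q) * Q) x y) t := fun x y t =>
    (hasDerivAt_exp_smul_apply Q (t - s) x y).comp_sub_const t s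
  have hc : ∀ x y, Continuous (fun t : ℝ => NormedSpace.exp ((t - s) • Q) x y) := fun x y =>
    continuous_iff_continuousAt.2 fun t => (hd x y t).continuousAt
  have hc' : ∀ x y, Continuous (fun t : ℝ => (NormedSpace.exp ((t - s) • Q) * Q) x y) := by
    intro x y
    simp only [Matrix.mul_apply]
    exact continuous_finsetSum _ fun z _ => (hc x z).mul continuous_const
  have := IsForward.eq_mul_propagator (isLocBddMatrix_const Q) hse
    (W := fun t => NormedSpace.exp ((t - s) • Q))
    ⟨fun x y => (hc x y).continuousOn, fun t ht x y => ?_⟩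
  · simpa using this.symm
  · rw [intervalIntegral.integral_eq_sub_of_hasDerivAt (fun u _ => hd x y u)
      ((hc' x y).intervalIntegrable _ _)]
    ring

/-- The derivative of W v is W K v = 0. Applied to a constant matrix and to its transpose, this
makes null vectors invariant under the semigroup on either side. -/
theorem propagator_mulVec_of_forall (hK : IsLocBddMatrix K) (hse : s ≤ e) (v : S → ℝ)
    (hv : ∀ t ∈ Set.Ioo s e, (K t).mulVec v = 0) : (propagator K s e).mulVec v = v := by
  have hF := propagator_isForward hK hse
  ext x
  have he := Set.right_mem_Icc.2 hse
  have hi := hK.intervalIntegrable_mul hse hF.continuousOn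
  rw [Matrix.mulVec, dotProduct, Finset.sum_congr rfl fun y _ => by rw [hF.eq e he x y, add_mul],
    Finset.sum_add_distrib, propagator_self hK]
  have h1 : ∑ y, (1 : Matrix S S ℝ) x y * v y = v x := by simp [Matrix.one_apply]
  rw [h1, add_eq_left, Finset.sum_congr rfl fun y _ => (intervalIntegral.integral_mul_const _ _).symm,
    ← intervalIntegral.integral_finsetSum fun y _ => (hi x y).mul_const _,
    intervalIntegral.integral_of_le hse, integral_Ioc_eq_integral_Ioo]
  rw [setIntegral_congr_fun (g := fun _ => (0 : ℝ)) measurableSet_Ioo fun t ht => ?_]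
  · simp
  · have := congrFun (Matrix.mulVec_mulVec v (propagator K s t) (K t)) x
    rw [hv t ht, Matrix.mulVec_zero] at this
    exact this.symm

theorem vecMul_exp_of_vecMul_eq_zero (Q : Matrix S S ℝ) (v : S → ℝ) (hv : Matrix.vecMul v Q = 0)
    (t : ℝ) (ht : 0 ≤ t) : Matrix.vecMul v (NormedSpace.exp (t • Q)) = v := by
  have h := propagator_mulVec_of_forall (isLocBddMatrix_const Q.transpose) ht v fun _ _ => by
    rw [Matrix.mulVec_transpose, hv]
  rw [propagator_const _ ht, sub_zero, ← Matrix.transpose_smul, Matrix.exp_transpose,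
    Matrix.mulVec_transpose] at h
  exact h

theorem exp_mulVec_of_mulVec_eq_zero (Q : Matrix S S ℝ) (v : S → ℝ) (hv : Matrix.mulVec Q v = 0)
    (t : ℝ) (ht : 0 ≤ t) : Matrix.mulVec (NormedSpace.exp (t • Q)) v = v := by
  have h := propagator_mulVec_of_forall (isLocBddMatrix_const Q) ht v fun _ _ => hv
  rwa [propagator_const _ ht, sub_zero] at h

/-- Removal of the diagonal part by a gauge transformation. -/
theorem propagator_gauge {B : ℝ → Matrix S S ℝ} {l : ℝ → S → ℝ} (hK : IsLocBddMatrix K)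
    (hB : IsLocBddMatrix B) (hse : s ≤ e) (hl : ∀ x, Measurable fun t => l t x)
    (hlb : ∃ C, ∀ t ∈ Set.Icc s e, ∀ x, |l t x| ≤ C)
    (h : ∀ t ∈ Set.Icc s e, ∀ x y, B t x y = Real.exp (-∫ u in s..t, l u x) *
      (K t x y + if x = y then l t x else 0) * Real.exp (∫ u in s..t, l u y)) (x y : S) :
    propagator K s e x y = propagator B s e x y * Real.exp (-∫ u in s..e, l u y) := by
  obtain ⟨C, hC⟩ := hlb
  have hF := propagator_isForward hB hse
  have hlint : ∀ y, ∀ t ∈ Set.Icc s e, IntervalIntegrable (fun u => l u y) volume s t := by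
    intro y t ht
    rw [intervalIntegrable_iff_integrableOn_Icc_of_le ht.1]
    exact Measure.integrableOn_of_bounded (M := C) (by simp) (hl y).aestronglyMeasurable
      ((ae_restrict_iff' measurableSet_Icc).2
        (Eventually.of_forall fun u hu => hC u ⟨hu.1, hu.2.trans ht.2⟩ y))
  have hexpc : ∀ y, ContinuousOn (fun t => Real.exp (-∫ u in s..t, l u y)) (Set.Icc s e) := by
    intro y
    have := intervalIntegral.continuousOn_primitive_interval'
      (hlint y e (Set.right_mem_Icc.2 hse)) (a := s) Set.left_mem_uIcc
    rw [Set.uIcc_of_le hse] at this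
    exact this.neg.rexp
  have hWc : ∀ x y, ContinuousOn
      (fun t => propagator B s t x y * Real.exp (-∫ u in s..t, l u y)) (Set.Icc s e) := fun x y =>
    (hF.continuousOn x y).mul (hexpc y)
  have := IsForward.eq_mul_propagator hK hse
    (W := fun t => Matrix.of fun x y => propagator B s t x y * Real.exp (-∫ u in s..t, l u y))
    ⟨hWc, fun t ht x y => ?_⟩
  · have h2 : (Matrix.of fun x y => propagator B s s x y * Real.exp (-∫ u in s..s, l u y)) =
        (1 : Matrix S S ℝ) := by
      ext x y; simp [propagator_self hB]
    simp only [h2, Matrix.one_mul] at this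
    rw [← this, Matrix.of_apply]
  · have hsub : Set.Icc s t ⊆ Set.Icc s e := Set.Icc_subset_Icc le_rfl ht.2
    have hFt := hF.mono ht.2
    have hi1 := hB.intervalIntegrable_mul ht.1 hFt.continuousOn x y
    have hi2 : IntervalIntegrable (fun v => -(l v y * Real.exp (-∫ u in s..v, l u y)))
        volume s t := by
      refine ((hlint y t ht).mul_continuousOn ?_).neg
      rw [Set.uIcc_of_le ht.1]
      exact (hexpc y).mono hsub
    have hexp : ∀ v ∈ Set.Icc s t, Real.exp (-∫ u in s..v, l u y) =
        1 + ∫ w in s..v, -(l w y * Real.exp (-∫ u in s..w, l u y)) := fun v hv =>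
      exp_neg_primitive hv.1 (hl y) fun u hu => hC u ⟨hu.1, hu.2.trans (hsub hv).2⟩ y
    simp only [Matrix.of_apply, intervalIntegral.integral_same, neg_zero, Real.exp_zero, mul_one]
    rw [hF.eq t ht x y, hexp t (Set.right_mem_Icc.2 ht.1), primitive_mul_primitive hi1 hi2, mul_one]
    congr 1
    refine intervalIntegral.integral_congr fun v hv => ?_
    rw [Set.uIcc_of_le ht.1] at hv
    rw [← hexp v hv, ← hF.eq v (hsub hv) x y]
    simp only [Matrix.mul_apply, Matrix.of_apply]
    -- The derivative of the exponential factor contributes −l on the diagonal, which cancels the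
    -- diagonal term l that B contains in addition to K.
    have hz : ∀ z, propagator B s v x z * B v z y * Real.exp (-∫ u in s..v, l u y) =
        propagator B s v x z * Real.exp (-∫ u in s..v, l u z) *
          (K v z y + if z = y then l v z else 0) := by
      intro z
      rw [h v (hsub hv)]
      have : Real.exp (∫ u in s..v, l u y) * Real.exp (-∫ u in s..v, l u y) = 1 := by
        rw [← Real.exp_add, add_neg_cancel, Real.exp_zero]
      linear_combination (propagator B s v x z * Real.exp (-∫ u in s..v, l u z) *
          (K v z y + if z = y then l v z else 0)) * this
    rw [Finset.sum_mul, Finset.sum_congr rfl fun z _ => hz z]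
    simp only [mul_add, Finset.sum_add_distrib, mul_ite, mul_zero, Finset.sum_ite_eq',
      Finset.mem_univ, if_true]
    ring

theorem dysonTerm_nonneg (h0 : ∀ t ∈ Set.Icc s e, ∀ x y, 0 ≤ K t x y) (n : ℕ) {t : ℝ}
    (ht : t ∈ Set.Icc s e) (x y : S) : 0 ≤ dysonTerm K s n t x y := by
  induction n generalizing t x y with
  | zero => simp only [dysonTerm, Matrix.one_apply]; split_ifs <;> simp
  | succ n ih =>
    refine intervalIntegral.integral_nonneg ht.1 fun u hu => ?_
    have hu' : u ∈ Set.Icc s e := ⟨hu.1, hu.2.trans ht.2⟩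
    rw [Matrix.mul_apply]
    exact Finset.sum_nonneg fun z _ => mul_nonneg (ih hu' x z) (h0 u hu' z y)

/-- All Dyson terms are nonnegative, and the zeroth one is the identity. -/
theorem one_le_propagator (hK : IsLocBddMatrix K) (hse : s ≤ e)
    (h0 : ∀ t ∈ Set.Icc s e, ∀ x y, 0 ≤ K t x y) (x y : S) :
    (1 : Matrix S S ℝ) x y ≤ propagator K s e x y :=
  le_hasSum (hasSum_dysonTerm hK hse x y) 0 fun n _ =>
    dysonTerm_nonneg h0 n (Set.right_mem_Icc.2 hse) x y

end PropagatorTheory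

/-! ### The simplex of jump times, fibred over the last jump. -/

section JumpTimes

variable {s e : ℝ} {n : ℕ}

theorem measurableSet_jumpTimes (s e : ℝ) (n : ℕ) : MeasurableSet (jumpTimes s e n) := by
  have h : jumpTimes s e n = (⋂ i, ⋂ j, {t : Fin n → ℝ | i < j → t i < t j}) ∩
      ⋂ j, {t : Fin n → ℝ | s < t j ∧ t j < e} := by
    ext t
    simp [jumpTimes, StrictMono]
  rw [h]
  refine (MeasurableSet.iInter fun i => MeasurableSet.iInter fun j => ?_).inter
    (MeasurableSet.iInter fun j => ?_)
  · by_cases hij : i < j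
    · simpa [hij] using measurableSet_lt (measurable_pi_apply i) (measurable_pi_apply j)
    · simp [hij]
  · exact (measurableSet_lt measurable_const (measurable_pi_apply j)).inter
      (measurableSet_lt (measurable_pi_apply j) measurable_const)

theorem volume_jumpTimes_lt_top (s e : ℝ) (n : ℕ) : volume (jumpTimes s e n) < ⊤ := by
  refine (measure_mono (t := Set.Icc (fun _ => s) fun _ => e) fun t ht => ?_).trans_lt
    isCompact_Icc.measure_lt_top
  exact ⟨fun j => (ht.2 j).1.le, fun j => (ht.2 j).2.le⟩

theorem snoc_mem_jumpTimes {t : Fin n → ℝ} {u : ℝ} :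
    (Fin.snoc t u : Fin (n + 1) → ℝ) ∈ jumpTimes s e (n + 1) ↔
      u ∈ Set.Ioo s e ∧ t ∈ jumpTimes s u n := by
  constructor
  · rintro ⟨h1, h2⟩
    refine ⟨by simpa using h2 (Fin.last n), fun i j hij => ?_, fun j => ⟨?_, ?_⟩⟩
    · simpa using h1 (Fin.castSucc_lt_castSucc_iff.2 hij)
    · simpa using (h2 j.castSucc).1
    · simpa using h1 (Fin.castSucc_lt_last j)
  · rintro ⟨hu, h1, h2⟩
    refine ⟨fun i j hij => ?_, fun j => ?_⟩
    · induction j using Fin.lastCases with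
      | last =>
        induction i using Fin.lastCases with
        | last => exact absurd hij (lt_irrefl _)
        | cast i => simpa using (h2 i).2
      | cast j =>
        induction i using Fin.lastCases with
        | last => exact absurd (hij.trans (Fin.castSucc_lt_last j)) (lt_irrefl _)
        | cast i => simpa using h1 (Fin.castSucc_lt_castSucc_iff.1 hij)
    · induction j using Fin.lastCases with
      | last => simpa using hu
      | cast j => simpa using ⟨(h2 j).1, (h2 j).2.trans hu.2⟩

/-- Integration over the jump times, with the last jump time as the outermost variable. -/
theorem setIntegral_jumpTimes_succ {f : (Fin (n + 1) → ℝ) → ℝ}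
    (hf : IntegrableOn f (jumpTimes s e (n + 1))) :
    IntegrableOn (fun u => ∫ t in jumpTimes s u n, f (Fin.snoc t u)) (Set.Ioo s e) ∧
    ∫ t in jumpTimes s e (n + 1), f t =
      ∫ u in Set.Ioo s e, ∫ t in jumpTimes s u n, f (Fin.snoc t u) := by
  have hmp := (volume_preserving_piFinSuccAbove (fun _ : Fin (n + 1) => ℝ) (Fin.last n)).symm
  have hap : ∀ q : ℝ × (Fin n → ℝ),
      (MeasurableEquiv.piFinSuccAbove (fun _ : Fin (n + 1) => ℝ) (Fin.last n)).symm q =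
        Fin.snoc q.2 q.1 := fun q => by
    simp [MeasurableEquiv.piFinSuccAbove_symm_apply, Fin.insertNthEquiv]
  rw [← integrable_indicator_iff (measurableSet_jumpTimes _ _ _)] at hf
  rw [← integrable_indicator_iff measurableSet_Ioo,
    ← integral_indicator (measurableSet_jumpTimes _ _ _), ← integral_indicator measurableSet_Ioo]
  have hf' := (hmp.integrable_comp_emb (MeasurableEquiv.measurableEmbedding _)).2 hf
  have hI := hmp.integral_comp (MeasurableEquiv.measurableEmbedding _)
    ((jumpTimes s e (n + 1)).indicator f)
  have hin : ∀ u, ∫ t, (jumpTimes s e (n + 1)).indicator f (Fin.snoc t u) =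
      (Set.Ioo s e).indicator (fun u => ∫ t in jumpTimes s u n, f (Fin.snoc t u)) u := by
    intro u
    by_cases hu : u ∈ Set.Ioo s e
    · rw [Set.indicator_of_mem hu, ← integral_indicator (measurableSet_jumpTimes _ _ _)]
      refine integral_congr_ae (Eventually.of_forall fun t => ?_)
      by_cases ht : t ∈ jumpTimes s u n
      · simp only [Set.indicator_of_mem ht, Set.indicator_of_mem (snoc_mem_jumpTimes.2 ⟨hu, ht⟩)]
      · simp only [Set.indicator_of_notMem ht,
          Set.indicator_of_notMem fun h => ht (snoc_mem_jumpTimes.1 h).2]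
    · rw [Set.indicator_of_notMem hu]
      refine integral_eq_zero_of_ae (Eventually.of_forall fun t => ?_)
      exact Set.indicator_of_notMem (fun h => hu (snoc_mem_jumpTimes.1 h).1) _
  simp only [Function.comp_def, hap] at hf'
  simp only [hap] at hI
  rw [← hI, Measure.volume_eq_prod, integral_prod _ hf']
  have h1 := Integrable.integral_prod_left hf'
  simp only [hin] at h1 ⊢
  exact ⟨h1, trivial⟩

end JumpTimes

/-! ### Path integrals as matrix elements of propagators. -/

section PathIntegral

variable {S : Type*} [Fintype S] [DecidableEq S] {K : ℝ → Matrix S S ℝ} {s e : ℝ}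

omit [Fintype S] [DecidableEq S] in
theorem integrableOn_jumpTimes_prod (hK : IsLocBddMatrix K) (φ χ : S → ℝ) {n : ℕ}
    (x : Fin (n + 1) → S) :
    IntegrableOn (fun t : Fin n → ℝ =>
      φ (x 0) * (∏ j : Fin n, K (t j) (x j.castSucc) (x j.succ)) * χ (x (Fin.last n)))
      (jumpTimes s e n) := by
  obtain ⟨C, hC⟩ := hK.bounded s e
  refine Measure.integrableOn_of_bounded (M := |φ (x 0)| * C ^ n * |χ (x (Fin.last n))|)
    (volume_jumpTimes_lt_top s e n).ne ?_ ?_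
  · refine Measurable.aestronglyMeasurable ?_
    refine (measurable_const.mul (Finset.measurable_prod _ fun j _ => ?_)).mul measurable_const
    exact (hK.measurable _ _).comp (measurable_pi_apply j)
  · refine (ae_restrict_iff' (measurableSet_jumpTimes _ _ _)).2 (Eventually.of_forall fun t ht => ?_)
    rw [Real.norm_eq_abs, abs_mul, abs_mul, Finset.abs_prod]
    gcongr
    calc ∏ j, |K (t j) (x j.castSucc) (x j.succ)| ≤ ∏ _j : Fin n, C :=
          Finset.prod_le_prod (fun _ _ => abs_nonneg _) fun j _ =>
            hC (t j) ⟨(ht.2 j).1.le, (ht.2 j).2.le⟩ _ _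
      _ = C ^ n := by simp

/-- Paths with n jumps make up the n-th Dyson term. The induction peels off the last jump, at time u
to the state y, and replaces χ by z ↦ K u z y * χ y; this is why e and χ are quantified after n. -/
theorem sum_setIntegral_jumpTimes (hK : IsLocBddMatrix K) (φ : S → ℝ) (n : ℕ) :
    ∀ (e : ℝ) (χ : S → ℝ), s ≤ e →
      ∑ x : Fin (n + 1) → S, ∫ t in jumpTimes s e n,
        φ (x 0) * (∏ j : Fin n, K (t j) (x j.castSucc) (x j.succ)) * χ (x (Fin.last n)) =
      ∑ x, ∑ y, φ x * dysonTerm K s n e x y * χ y := by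
  induction n with
  | zero =>
    intro e χ _
    have h1 : jumpTimes s e 0 = Set.univ := Set.eq_univ_of_forall fun t =>
      ⟨fun i => i.elim0, fun j => j.elim0⟩
    rw [← (Equiv.funUnique (Fin 1) S).symm.sum_comp]
    refine Finset.sum_congr rfl fun x _ => ?_
    simp [h1, dysonTerm, Matrix.one_apply, Measure.real, volume_pi]
  | succ n ih =>
    intro e χ hse
    rw [← (Fin.snocEquiv fun _ : Fin (n + 2) => S).sum_comp, Fintype.sum_prod_type]
    have hsl := fun y (x : Fin (n + 1) → S) => setIntegral_jumpTimes_succ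
      (integrableOn_jumpTimes_prod hK (s := s) (e := e) φ χ (Fin.snoc x y : Fin (n + 2) → S))
    have hsplit : ∀ y (x : Fin (n + 1) → S) (t : Fin n → ℝ) (u : ℝ),
        φ ((Fin.snoc x y : Fin (n + 2) → S) 0) *
          (∏ j : Fin (n + 1), K ((Fin.snoc t u : Fin (n + 1) → ℝ) j)
            ((Fin.snoc x y : Fin (n + 2) → S) j.castSucc)
            ((Fin.snoc x y : Fin (n + 2) → S) j.succ)) *
          χ ((Fin.snoc x y : Fin (n + 2) → S) (Fin.last (n + 1))) =
        φ (x 0) * (∏ j : Fin n, K (t j) (x j.castSucc) (x j.succ)) *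
          (K u (x (Fin.last n)) y * χ y) := by
      intro y x t u
      have h0 : (Fin.snoc x y : Fin (n + 2) → S) 0 = x 0 := by
        rw [← Fin.castSucc_zero, Fin.snoc_castSucc]
      rw [Fin.prod_univ_castSucc, h0]
      simp only [Fin.snoc_castSucc, Fin.snoc_last, ← Fin.castSucc_succ, Fin.succ_last]
      ring
    simp only [hsplit] at hsl
    have heq : ∀ y (x : Fin (n + 1) → S),
        (Fin.snocEquiv fun _ : Fin (n + 2) => S) (y, x) = Fin.snoc x y := fun _ _ => rfl
    have hi := hK.intervalIntegrable_mul hse (dysonTerm_continuousOn hK hse n)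
    calc _ = ∑ y, ∑ x : Fin (n + 1) → S, ∫ u in Set.Ioo s e, ∫ t in jumpTimes s u n,
          φ (x 0) * (∏ j : Fin n, K (t j) (x j.castSucc) (x j.succ)) *
          (K u (x (Fin.last n)) y * χ y) :=
          Finset.sum_congr rfl fun y _ => Finset.sum_congr rfl fun x _ => by
            rw [heq]; exact (hsl y x).2
      _ = ∑ y, ∫ u in Set.Ioo s e, ∑ x : Fin (n + 1) → S, ∫ t in jumpTimes s u n,
          φ (x 0) * (∏ j : Fin n, K (t j) (x j.castSucc) (x j.succ)) *
          (K u (x (Fin.last n)) y * χ y) :=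
          Finset.sum_congr rfl fun y _ =>
            (integral_finsetSum _ fun x _ => (hsl y x).1).symm
      _ = ∑ y, ∫ u in Set.Ioo s e, ∑ x, φ x * (dysonTerm K s n u * K u) x y * χ y := by
          refine Finset.sum_congr rfl fun y _ =>
            setIntegral_congr_fun measurableSet_Ioo fun u hu => ?_
          rw [ih u (fun z => K u z y * χ y) hu.1.le]
          refine Finset.sum_congr rfl fun x _ => ?_
          rw [Matrix.mul_apply, Finset.mul_sum, Finset.sum_mul]
          exact Finset.sum_congr rfl fun z _ => by ring
      _ = _ := by
          rw [Finset.sum_comm]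
          refine Finset.sum_congr rfl fun y _ => ?_
          rw [← integral_Ioc_eq_integral_Ioo, ← intervalIntegral.integral_of_le hse,
            intervalIntegral.integral_finsetSum
              fun x _ => ((hi x y).const_mul _).mul_const _]
          refine Finset.sum_congr rfl fun x _ => ?_
          rw [intervalIntegral.integral_mul_const, intervalIntegral.integral_const_mul]
          rfl

/-- The path integral of a product over the jumps. -/
theorem pathIntegral_prod (hK : IsLocBddMatrix K) (hdiag : ∀ t x, K t x x = 0) (hse : s ≤ e)
    (φ χ : S → ℝ) {f : JumpPath S → ℝ}
    (hf : ∀ p : JumpPath S, (∀ j : Fin p.numJumps, p.state j.castSucc ≠ p.state j.succ) →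
      p.jumpTime ∈ jumpTimes s e p.numJumps →
      f p = φ p.first *
        (∏ j : Fin p.numJumps, K (p.jumpTime j) (p.state j.castSucc) (p.state j.succ)) *
        χ p.last) :
    pathIntegral s e f = φ ⬝ᵥ (propagator K s e).mulVec χ := by
  have hn : ∀ n : ℕ, ∑ x : Fin (n + 1) → S with ∀ j : Fin n, x j.castSucc ≠ x j.succ,
      ∫ t in jumpTimes s e n, f ⟨n, x, t⟩ = ∑ x, ∑ y, φ x * dysonTerm K s n e x y * χ y := by
    intro n
    rw [← sum_setIntegral_jumpTimes hK φ n e χ hse, Finset.sum_filter]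
    refine Finset.sum_congr rfl fun x _ => ?_
    split_ifs with hx
    · exact setIntegral_congr_fun (measurableSet_jumpTimes _ _ _) fun t ht => hf ⟨n, x, t⟩ hx ht
    -- The sum on the matrix side runs over all sequences of states; those with a repeated neighbour
    -- vanish because the diagonal of K is zero.
    · push Not at hx
      obtain ⟨j, hj⟩ := hx
      refine (integral_eq_zero_of_ae (Eventually.of_forall fun t => ?_)).symm
      have : ∏ j : Fin n, K (t j) (x j.castSucc) (x j.succ) = 0 :=
        Finset.prod_eq_zero (Finset.mem_univ j) (by rw [hj, hdiag])
      simp [this]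
  unfold pathIntegral
  simp only [hn]
  refine HasSum.tsum_eq ?_
  have : φ ⬝ᵥ (propagator K s e).mulVec χ = ∑ x, ∑ y, φ x * propagator K s e x y * χ y := by
    simp only [dotProduct, Matrix.mulVec, Finset.mul_sum, mul_assoc]
  rw [this]
  exact hasSum_sum fun x _ => hasSum_sum fun y _ =>
    ((hasSum_dysonTerm hK hse x y).mul_left _).mul_right _

/-- Summation by parts along a path. -/
theorem JumpPath.sum_sub_time {S : Type*} (g : ℝ → S → ℝ) (s e : ℝ) (p : JumpPath S) :
    ∑ j : Fin (p.numJumps + 1), (g (p.time s e j.succ) (p.state j) -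
      g (p.time s e j.castSucc) (p.state j)) =
    g e p.last - g s p.first - ∑ j : Fin p.numJumps,
      (g (p.jumpTime j) (p.state j.succ) - g (p.jumpTime j) (p.state j.castSucc)) := by
  have h1 : ∀ j : Fin p.numJumps, p.time s e j.castSucc.succ = p.jumpTime j := fun j => by
    simp [JumpPath.time]
  have h2 : p.time s e (Fin.last p.numJumps).succ = e := by simp [JumpPath.time, -Fin.succ_last]
  have h3 : p.time s e (Fin.castSucc 0) = s := by simp [JumpPath.time]
  have h4 : ∀ j : Fin p.numJumps, p.time s e j.succ.castSucc = p.jumpTime j := fun j => by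
    rw [← Fin.succ_castSucc, h1]
  rw [Finset.sum_sub_distrib, Fin.sum_univ_castSucc]
  rw [Fin.sum_univ_succ (fun j => g (p.time s e j.castSucc) (p.state j))]
  simp only [h1, h2, h3, h4, Finset.sum_sub_distrib, JumpPath.first, JumpPath.last]
  ring

/-- The zero-diagonal matrix obtained by gauging away the diagonal part of `K`. -/
noncomputable def gaugedMatrix (K : ℝ → Matrix S S ℝ) (s : ℝ) (t : ℝ) : Matrix S S ℝ :=
  Matrix.of fun x y => if x = y then 0 else
    Real.exp (∫ u in s..t, K u x x) * K t x y * Real.exp (-∫ u in s..t, K u y y)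

theorem isLocBddMatrix_gaugedMatrix (hK : IsLocBddMatrix K) (s : ℝ) :
    IsLocBddMatrix (gaugedMatrix K s) := by
  have hc : ∀ x, Continuous fun t => ∫ u in s..t, K u x x := fun x =>
    intervalIntegral.continuous_primitive (fun a b => hK.intervalIntegrable a b x x) s
  refine ⟨fun x y => ?_, fun a b => ?_⟩
  · by_cases hxy : x = y
    · simp [gaugedMatrix, hxy]
    · simp only [gaugedMatrix, Matrix.of_apply, hxy, if_false]
      exact ((hc x).rexp.measurable.mul (hK.measurable x y)).mul (hc y).neg.rexp.measurable
  · obtain ⟨C, hC⟩ := hK.bounded a b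
    have hb : ∀ x y, ∃ D, ∀ t ∈ Set.Icc a b, |gaugedMatrix K s t x y| ≤ D := by
      intro x y
      by_cases hxy : x = y
      · exact ⟨0, by simp [gaugedMatrix, hxy]⟩
      · obtain ⟨C1, h1⟩ := (isCompact_Icc (a := a) (b := b)).exists_bound_of_continuousOn
          (hc x).rexp.continuousOn
        obtain ⟨C2, h2⟩ := (isCompact_Icc (a := a) (b := b)).exists_bound_of_continuousOn
          (hc y).neg.rexp.continuousOn
        refine ⟨C1 * C * C2, fun t ht => ?_⟩
        simp only [gaugedMatrix, Matrix.of_apply, hxy, if_false]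
        rw [abs_mul, abs_mul]
        have hC1 : 0 ≤ C1 := (norm_nonneg _).trans (h1 t ht)
        have hC0 : 0 ≤ C := (abs_nonneg _).trans (hC t ht x y)
        exact mul_le_mul (mul_le_mul (h1 t ht) (hC t ht x y) (abs_nonneg _) hC1) (h2 t ht)
          (abs_nonneg _) (mul_nonneg hC1 hC0)
    choose D hD using hb
    exact ⟨∑ x, ∑ y, |D x y|, fun t ht x y => ((hD x y t ht).trans (le_abs_self _)).trans <|
      (Finset.single_le_sum (f := fun y => |D x y|) (fun _ _ => abs_nonneg _)
        (Finset.mem_univ y)).trans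
      (Finset.single_le_sum (f := fun x => ∑ y, |D x y|)
        (fun _ _ => Finset.sum_nonneg fun _ _ => abs_nonneg _) (Finset.mem_univ x))⟩

theorem propagator_eq_gauged (hK : IsLocBddMatrix K) (hse : s ≤ e) (x y : S) :
    propagator K s e x y =
      propagator (gaugedMatrix K s) s e x y * Real.exp (∫ u in s..e, K u y y) := by
  obtain ⟨C, hC⟩ := hK.bounded s e
  have := propagator_gauge (l := fun t x => -K t x x) hK (isLocBddMatrix_gaugedMatrix hK s) hse
    (fun x => (hK.measurable x x).neg) ⟨C, fun t ht x => by rw [abs_neg]; exact hC t ht x x⟩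
    (fun t _ x y => ?_) x y
  · simpa only [intervalIntegral.integral_neg, neg_neg] using this
  · simp only [intervalIntegral.integral_neg, neg_neg, gaugedMatrix, Matrix.of_apply]
    by_cases hxy : x = y
    · subst hxy; simp
    · simp [hxy]

omit [Fintype S] in
theorem gaugedMatrix_nonneg {t : ℝ} (h : ∀ x y, x ≠ y → 0 ≤ K t x y) (x y : S) :
    0 ≤ gaugedMatrix K s t x y := by
  simp only [gaugedMatrix, Matrix.of_apply]
  split_ifs with hxy
  · exact le_rfl
  · exact mul_nonneg (mul_nonneg (Real.exp_pos _).le (h x y hxy)) (Real.exp_pos _).le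

theorem propagator_nonneg (hK : IsLocBddMatrix K) (hse : s ≤ e)
    (h : ∀ t ∈ Set.Icc s e, ∀ x y, x ≠ y → 0 ≤ K t x y) (x y : S) :
    0 ≤ propagator K s e x y := by
  rw [propagator_eq_gauged hK hse]
  have := one_le_propagator (isLocBddMatrix_gaugedMatrix hK s) hse
    (fun t ht => gaugedMatrix_nonneg (h t ht)) x y
  refine mul_nonneg (le_trans ?_ this) (Real.exp_pos _).le
  rw [Matrix.one_apply]; split_ifs <;> simp

theorem propagator_self_pos (hK : IsLocBddMatrix K) (hse : s ≤ e)
    (h : ∀ t ∈ Set.Icc s e, ∀ x y, x ≠ y → 0 ≤ K t x y) (x : S) :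
    0 < propagator K s e x x := by
  rw [propagator_eq_gauged hK hse]
  have := one_le_propagator (isLocBddMatrix_gaugedMatrix hK s) hse
    (fun t ht => gaugedMatrix_nonneg (h t ht)) x x
  rw [Matrix.one_apply_eq] at this
  exact mul_pos (zero_lt_one.trans_le this) (Real.exp_pos _)

/-- The path integral of a product over the jumps and over the intervals between them. -/
theorem pathIntegral_eq_propagator (hK : IsLocBddMatrix K) (hse : s ≤ e)
    (φ χ : S → ℝ) {f : JumpPath S → ℝ}
    (hf : ∀ p : JumpPath S, (∀ j : Fin p.numJumps, p.state j.castSucc ≠ p.state j.succ) →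
      p.jumpTime ∈ jumpTimes s e p.numJumps →
      f p = φ p.first * χ p.last *
        ((∏ j : Fin p.numJumps, K (p.jumpTime j) (p.state j.castSucc) (p.state j.succ)) *
          ∏ j : Fin (p.numJumps + 1), Real.exp
            (∫ t in (p.time s e j.castSucc)..(p.time s e j.succ), K t (p.state j) (p.state j)))) :
    pathIntegral s e f = φ ⬝ᵥ (propagator K s e).mulVec χ := by
  have hi := hK.intervalIntegrable
  rw [pathIntegral_prod (isLocBddMatrix_gaugedMatrix hK s) (by simp [gaugedMatrix]) hse φ
    (fun y => Real.exp (∫ u in s..e, K u y y) * χ y)]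
  · congr 1
    ext x
    simp only [Matrix.mulVec, dotProduct]
    exact Finset.sum_congr rfl fun y _ => by rw [propagator_eq_gauged hK hse, mul_assoc]
  · intro p hp ht
    rw [hf p hp ht, ← Real.exp_sum]
    -- Summation by parts for the primitives of the diagonal entries: the waiting factors become one
    -- boundary factor at the final state and factors at the jumps. The latter are exactly those
    -- that turn K into its gauged matrix.
    have h1 := JumpPath.sum_sub_time (fun t x => ∫ u in s..t, K u x x) s e p
    simp only [intervalIntegral.integral_interval_sub_left (hi _ _ _ _) (hi _ _ _ _)] at h1
    rw [h1, intervalIntegral.integral_same, sub_zero, Real.exp_sub, Real.exp_sum]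
    have h2 : ∏ j : Fin p.numJumps,
        gaugedMatrix K s (p.jumpTime j) (p.state j.castSucc) (p.state j.succ) =
        (∏ j : Fin p.numJumps, K (p.jumpTime j) (p.state j.castSucc) (p.state j.succ)) /
        ∏ j : Fin p.numJumps, Real.exp ((∫ u in s..p.jumpTime j, K u (p.state j.succ) (p.state j.succ))
          - ∫ u in s..p.jumpTime j, K u (p.state j.castSucc) (p.state j.castSucc)) := by
      rw [← Finset.prod_div_distrib]
      refine Finset.prod_congr rfl fun j _ => ?_
      simp only [gaugedMatrix, Matrix.of_apply, hp j, if_false]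
      rw [Real.exp_sub, Real.exp_neg]
      field_simp
    rw [h2]
    ring

end PathIntegral

/-! ### Perron–Frobenius theory for semigroups of connected rate matrices. -/

section PerronFrobenius

variable {S : Type*} [Fintype S] [DecidableEq S] {Q : Matrix S S ℝ}

/-- The off-diagonal entries are nonnegative, and the nonvanishing ones connect the index set. -/
structure IsConnectedRateMatrix {S : Type*} (Q : Matrix S S ℝ) : Prop where
  nonneg : ∀ x y, x ≠ y → 0 ≤ Q x y
  connected : ∀ x y, Relation.ReflTransGen (fun u v => u ≠ v ∧ Q u v ≠ 0) x y

theorem exp_add_smul (Q : Matrix S S ℝ) (a b : ℝ) :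
    NormedSpace.exp ((a + b) • Q) = NormedSpace.exp (a • Q) * NormedSpace.exp (b • Q) := by
  rw [add_smul]
  exact Matrix.exp_add_of_commute _ _ (((Commute.refl Q).smul_left a).smul_right b)

theorem exp_smul_apply_nonneg (h : ∀ x y, x ≠ y → 0 ≤ Q x y) {t : ℝ} (ht : 0 ≤ t) (x y : S) :
    0 ≤ NormedSpace.exp (t • Q) x y := by
  have := propagator_nonneg (isLocBddMatrix_const Q) ht (fun _ _ => h) x y
  rwa [propagator_const _ ht, sub_zero] at this

theorem exp_smul_apply_self_pos (h : ∀ x y, x ≠ y → 0 ≤ Q x y) {t : ℝ} (ht : 0 ≤ t) (x : S) :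
    0 < NormedSpace.exp (t • Q) x x := by
  have := propagator_self_pos (isLocBddMatrix_const Q) ht (fun _ _ => h) x
  rwa [propagator_const _ ht, sub_zero] at this

theorem exp_smul_apply_pos_of_mul (h : ∀ x y, x ≠ y → 0 ≤ Q x y) {a b : ℝ} (ha : 0 ≤ a)
    (hb : 0 ≤ b) {x y z : S} (h1 : 0 < NormedSpace.exp (a • Q) x y)
    (h2 : 0 < NormedSpace.exp (b • Q) y z) : 0 < NormedSpace.exp ((a + b) • Q) x z := by
  rw [exp_add_smul, Matrix.mul_apply]
  exact Finset.sum_pos' (fun w _ => mul_nonneg (exp_smul_apply_nonneg h ha x w)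
    (exp_smul_apply_nonneg h hb w z)) ⟨y, Finset.mem_univ y, mul_pos h1 h2⟩

/-- The derivative of the entry at time 0 is Q x y > 0, so the entry is positive at some small time
a < t; the remaining time t − a is spent at y. -/
theorem exp_smul_apply_pos_of_apply_pos (h : ∀ x y, x ≠ y → 0 ≤ Q x y) {x y : S} (hxy : x ≠ y)
    (hQ : 0 < Q x y) {t : ℝ} (ht : 0 < t) : 0 < NormedSpace.exp (t • Q) x y := by
  have hd := hasDerivAt_exp_smul_apply Q 0 x y
  rw [zero_smul, NormedSpace.exp_zero, Matrix.one_mul, hasDerivAt_iff_tendsto_slope] at hd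
  have h1 : ∀ᶠ a in 𝓝[>] (0 : ℝ), 0 < slope (fun t : ℝ => NormedSpace.exp (t • Q) x y) 0 a :=
    (hd.mono_left (nhdsWithin_mono _ fun a ha => (ne_of_gt ha : a ≠ 0))).eventually
      (lt_mem_nhds hQ)
  have h2 : ∀ᶠ a in 𝓝[>] (0 : ℝ), a ∈ Set.Ioo 0 t := Ioo_mem_nhdsGT ht
  obtain ⟨a, ha1, ha0, hat⟩ := (h1.and h2).exists
  rw [slope_def_field, sub_zero, zero_smul, NormedSpace.exp_zero, Matrix.one_apply_ne hxy,
    sub_zero] at ha1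
  have := exp_smul_apply_pos_of_mul h ha0.le (sub_nonneg.2 hat.le)
    ((div_pos_iff_of_pos_right ha0).1 ha1) (exp_smul_apply_self_pos h (sub_nonneg.2 hat.le) y)
  rwa [add_sub_cancel] at this

theorem IsConnectedRateMatrix.exp_smul_apply_pos (h : IsConnectedRateMatrix Q) (x y : S) {t : ℝ}
    (ht : 0 < t) : 0 < NormedSpace.exp (t • Q) x y := by
  induction h.connected x y generalizing t with
  | refl => exact exp_smul_apply_self_pos h.nonneg ht.le x
  | tail _ hbc ih =>
    have := exp_smul_apply_pos_of_mul h.nonneg (half_pos ht).le (half_pos ht).le (ih (half_pos ht))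
      (exp_smul_apply_pos_of_apply_pos h.nonneg hbc.1
        (lt_of_le_of_ne (h.nonneg _ _ hbc.1) hbc.2.symm) (half_pos ht))
    rwa [add_halves] at this

/-- Powers of a positive matrix with a positive fixed vector `r` and fixed covector `l`. -/
theorem tendsto_pow_vecMulVec {P : Matrix S S ℝ} (hP : ∀ x y, 0 < P x y) {r l : S → ℝ}
    (hr : ∀ x, 0 < r x) (hPr : P.mulVec r = r) (hlP : Matrix.vecMul l P = l) (hlr : l ⬝ᵥ r = 1) :
    Tendsto (fun n : ℕ => P ^ n) atTop (𝓝 (Matrix.vecMulVec r l)) := by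
  -- A Doeblin minorization: a small multiple of the limit R = r lᵀ fits entrywise below P. No sign
  -- of l is needed. The remainder A is nonnegative and contracts r by 1 − δ, so its powers tend to
  -- 0.
  obtain ⟨δ, ⟨hδ0, hδ1⟩, hδ⟩ : ∃ δ : ℝ, δ ∈ Set.Ioo (0 : ℝ) 1 ∧ ∀ x y, δ * (r x * l y) < P x y := by
    have h1 : ∀ᶠ δ in 𝓝[>] (0 : ℝ), ∀ x y, δ * (r x * l y) < P x y := by
      rw [eventually_all]; intro x
      rw [eventually_all]; intro y
      have : Tendsto (fun δ : ℝ => δ * (r x * l y)) (𝓝[>] 0) (𝓝 (0 * (r x * l y))) :=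
        ((continuous_id.mul continuous_const).tendsto 0).mono_left nhdsWithin_le_nhds
      rw [zero_mul] at this
      exact this.eventually (gt_mem_nhds (hP x y))
    have h2 : ∀ᶠ δ in 𝓝[>] (0 : ℝ), δ ∈ Set.Ioo (0 : ℝ) 1 := Ioo_mem_nhdsGT zero_lt_one
    exact (h2.and h1).exists
  set R := Matrix.vecMulVec r l with hR
  set A := P - δ • R with hA
  have hRr : R.mulVec r = r := by
    rw [hR, Matrix.vecMulVec_mulVec, hlr]
    simp
  have hAr : A.mulVec r = (1 - δ) • r := by
    rw [hA, Matrix.sub_mulVec, Matrix.smul_mulVec, hPr, hRr, sub_smul, one_smul]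
  have hAnr : ∀ n : ℕ, (A ^ n).mulVec r = (1 - δ) ^ n • r := by
    intro n
    induction n with
    | zero => simp
    | succ n ih =>
      rw [pow_succ, ← Matrix.mulVec_mulVec, hAr, Matrix.mulVec_smul, ih, smul_smul, pow_succ,
        mul_comm]
  have hAnn : ∀ n : ℕ, ∀ x y, 0 ≤ (A ^ n) x y := by
    intro n
    induction n with
    | zero => intro x y; rw [pow_zero, Matrix.one_apply]; split_ifs <;> simp
    | succ n ih =>
      intro x y
      rw [pow_succ, Matrix.mul_apply]
      refine Finset.sum_nonneg fun z _ => mul_nonneg (ih x z) ?_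
      simp only [hA, hR, Matrix.sub_apply, Matrix.smul_apply, Matrix.vecMulVec_apply, smul_eq_mul]
      exact sub_nonneg.2 (hδ z y).le
  have hAlim : Tendsto (fun n : ℕ => A ^ n) atTop (𝓝 0) := by
    refine tendsto_pi_nhds.2 fun x => tendsto_pi_nhds.2 fun y => ?_
    have hle : ∀ n : ℕ, (A ^ n) x y ≤ (1 - δ) ^ n * (r x / r y) := by
      intro n
      rw [← mul_div_assoc, le_div_iff₀ (hr y)]
      have := congrFun (hAnr n) x
      simp only [Matrix.mulVec, dotProduct, Pi.smul_apply, smul_eq_mul] at this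
      rw [← this]
      exact Finset.single_le_sum (f := fun z => (A ^ n) x z * r z)
        (fun z _ => mul_nonneg (hAnn n x z) (hr z).le) (Finset.mem_univ y)
    refine squeeze_zero (fun n => hAnn n x y) hle ?_
    have := (tendsto_pow_atTop_nhds_zero_of_lt_one (sub_nonneg.2 hδ1.le)
      (sub_lt_self 1 hδ0)).mul_const (r x / r y)
    rwa [zero_mul] at this
  -- The induction uses R P = R and A^n R = (1 − δ)^n R.
  have hform : ∀ n : ℕ, P ^ n = A ^ n + (1 - (1 - δ) ^ n) • R := by
    intro n
    have hRP : R * P = R := by rw [hR, Matrix.vecMulVec_mul, hlP]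
    induction n with
    | zero => simp
    | succ n ih =>
      have hAR : A ^ n * R = (1 - δ) ^ n • R := by
        rw [hR, Matrix.mul_vecMulVec, hAnr, Matrix.smul_vecMulVec]
      have hPA : P = A + δ • R := by rw [hA, sub_add_cancel]
      rw [pow_succ, ih, add_mul, Matrix.smul_mul, hRP]
      nth_rewrite 1 [hPA]
      rw [mul_add, ← pow_succ, Matrix.mul_smul, hAR, add_assoc, smul_smul, ← add_smul]
      congr 2
      ring
  have hpow := tendsto_pow_atTop_nhds_zero_of_lt_one (sub_nonneg.2 hδ1.le) (sub_lt_self 1 hδ0)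
  have hcoef := (tendsto_const_nhds (x := (1 : ℝ)) (f := atTop (α := ℕ))).sub hpow
  have := hAlim.add (hcoef.smul (tendsto_const_nhds (x := R)))
  simp only [← hform, sub_zero, one_smul, zero_add] at this
  exact this

/-- Convergence of the semigroup of a connected rate matrix with vanishing leading eigenvalue. -/
theorem IsConnectedRateMatrix.tendsto_exp_of_mulVec_eq_zero (h : IsConnectedRateMatrix Q)
    {r l : S → ℝ} (hr : ∀ x, 0 < r x) (hQr : Q.mulVec r = 0) (hlQ : Matrix.vecMul l Q = 0)
    (hlr : l ⬝ᵥ r = 1) :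
    Tendsto (fun t : ℝ => NormedSpace.exp (t • Q)) atTop (𝓝 (Matrix.vecMulVec r l)) := by
  have hpow := (tendsto_pow_vecMulVec (P := NormedSpace.exp ((1 : ℝ) • Q))
    (fun x y => h.exp_smul_apply_pos x y zero_lt_one) hr
    (exp_mulVec_of_mulVec_eq_zero Q r hQr 1 zero_le_one)
    (vecMul_exp_of_vecMul_eq_zero Q l hlQ 1 zero_le_one) hlr).comp
      (tendsto_nat_floor_atTop (α := ℝ))
  refine tendsto_pi_nhds.2 fun x => tendsto_pi_nhds.2 fun y => ?_
  rw [tendsto_iff_dist_tendsto_zero]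
  have hlim : Tendsto (fun t : ℝ => ∑ z, r x / r z *
      |(NormedSpace.exp ((1 : ℝ) • Q) ^ ⌊t⌋₊) z y - Matrix.vecMulVec r l z y|) atTop (𝓝 0) := by
    rw [← Finset.sum_const_zero (s := (Finset.univ : Finset S))]
    refine tendsto_finsetSum _ fun z _ => ?_
    have h1 := tendsto_pi_nhds.1 (tendsto_pi_nhds.1 hpow z) y
    have h2 := (h1.sub_const (Matrix.vecMulVec r l z y)).abs.const_mul (r x / r z)
    simpa using h2
  refine squeeze_zero' (Eventually.of_forall fun _ => dist_nonneg) ?_ hlim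
  filter_upwards [eventually_ge_atTop (0 : ℝ)] with t ht
  have hf0 : 0 ≤ t - ⌊t⌋₊ := sub_nonneg.2 (Nat.floor_le ht)
  set E := NormedSpace.exp ((t - ⌊t⌋₊) • Q) with hE
  have hEr : E.mulVec r = r := exp_mulVec_of_mulVec_eq_zero Q r hQr _ hf0
  -- Noninteger times: the fractional factor E fixes R, and its entries are bounded by r x / r z
  -- because E r = r. Convergence at integer times is therefore enough.
  have hdec : NormedSpace.exp (t • Q) = E * NormedSpace.exp ((1 : ℝ) • Q) ^ ⌊t⌋₊ := by
    rw [← Matrix.exp_nsmul, hE, ← Nat.cast_smul_eq_nsmul ℝ, one_smul, ← exp_add_smul,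
      sub_add_cancel]
  have hER : E * Matrix.vecMulVec r l = Matrix.vecMulVec r l := by
    rw [Matrix.mul_vecMulVec, hEr]
  have hEnn := exp_smul_apply_nonneg h.nonneg hf0
  have hle : ∀ z, E x z ≤ r x / r z := by
    intro z
    rw [le_div_iff₀ (hr z), ← congrFun hEr x]
    exact Finset.single_le_sum (f := fun z => E x z * r z)
      (fun z _ => mul_nonneg (hEnn x z) (hr z).le) (Finset.mem_univ z)
  rw [Real.dist_eq, hdec]
  nth_rewrite 1 [← hER]
  rw [Matrix.mul_apply, Matrix.mul_apply, ← Finset.sum_sub_distrib]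
  refine (Finset.abs_sum_le_sum_abs _ _).trans (Finset.sum_le_sum fun z _ => ?_)
  rw [← mul_sub, abs_mul, abs_of_nonneg (hEnn x z)]
  exact mul_le_mul_of_nonneg_right (hle z) (abs_nonneg _)

theorem exp_smul_sub_smul_one (Q : Matrix S S ℝ) (μ t : ℝ) :
    NormedSpace.exp (t • (Q - μ • (1 : Matrix S S ℝ))) =
      Real.exp (-(μ * t)) • NormedSpace.exp (t • Q) := by
  have h1 : t • (Q - μ • (1 : Matrix S S ℝ)) =
      Matrix.diagonal (fun _ => -(μ * t)) + t • Q := by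
    rw [← Matrix.smul_one_eq_diagonal, smul_sub, smul_smul, neg_smul, mul_comm]
    abel
  have h2 : Commute (Matrix.diagonal fun _ : S => -(μ * t)) (t • Q) := by
    rw [← Matrix.smul_one_eq_diagonal]
    exact (Commute.one_left _).smul_left _
  rw [h1, Matrix.exp_add_of_commute _ _ h2, Matrix.exp_diagonal]
  have h3 : NormedSpace.exp (fun _ : S => -(μ * t)) = fun _ => Real.exp (-(μ * t)) := by
    ext x
    rw [Pi.coe_exp, Real.exp_eq_exp_ℝ]
  rw [h3, ← Matrix.smul_one_eq_diagonal, Matrix.smul_mul, Matrix.one_mul]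

omit [Fintype S] in
theorem IsConnectedRateMatrix.sub_smul_one (h : IsConnectedRateMatrix Q) (μ : ℝ) :
    IsConnectedRateMatrix (Q - μ • (1 : Matrix S S ℝ)) := by
  have : ∀ x y, x ≠ y → (Q - μ • (1 : Matrix S S ℝ)) x y = Q x y := fun x y hxy => by
    simp [Matrix.one_apply_ne hxy]
  refine ⟨fun x y hxy => (this x y hxy).symm ▸ h.nonneg x y hxy, fun x y => ?_⟩
  exact Relation.ReflTransGen.mono (fun u v huv => ⟨huv.1, (this u v huv.1).symm ▸ huv.2⟩) x y (h.connected x y)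

/-- Long-time asymptotics of the semigroup of a connected rate matrix. -/
theorem IsConnectedRateMatrix.tendsto_exp (h : IsConnectedRateMatrix Q)
    {r l : S → ℝ} {μ : ℝ} (hr : ∀ x, 0 < r x) (hQr : Q.mulVec r = μ • r)
    (hlQ : Matrix.vecMul l Q = μ • l) (hlr : l ⬝ᵥ r = 1) :
    Tendsto (fun t : ℝ => Real.exp (-(μ * t)) • NormedSpace.exp (t • Q)) atTop
      (𝓝 (Matrix.vecMulVec r l)) := by
  simp only [← exp_smul_sub_smul_one]
  refine (h.sub_smul_one μ).tendsto_exp_of_mulVec_eq_zero hr ?_ ?_ hlr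
  · rw [Matrix.sub_mulVec, hQr, Matrix.smul_mulVec, Matrix.one_mulVec, sub_self]
  · rw [Matrix.vecMul_sub, hlQ, Matrix.vecMul_smul, Matrix.vecMul_one, sub_self]

/-- The Perron–Frobenius eigenvector of a symmetric connected rate matrix. -/
theorem IsConnectedRateMatrix.exists_pos_eigenvector [Nonempty S] (h : IsConnectedRateMatrix Q)
    (hsymm : Q.IsSymm) :
    ∃ (μ : ℝ) (v : S → ℝ), (∀ x, 0 < v x) ∧ Q.mulVec v = μ • v ∧ v ⬝ᵥ v = 1 := by
  set T := Matrix.toEuclideanCLM (𝕜 := ℝ) Q with hT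
  have hsa : IsSelfAdjoint T := by
    refine IsSelfAdjoint.map (f := Matrix.toEuclideanCLM (n := S) (𝕜 := ℝ)) ?_
    rw [IsSelfAdjoint, Matrix.star_eq_conjTranspose, Matrix.conjTranspose_eq_transpose_of_trivial]
    exact hsymm
  have hTv : ∀ v : EuclideanSpace ℝ S, ∀ x, T v x = ∑ y, Q x y * v y := fun v x => rfl
  have hq : ∀ v : EuclideanSpace ℝ S, T.reApplyInnerSelf v = ∑ x, ∑ y, Q x y * (v x * v y) := by
    intro v
    rw [ContinuousLinearMap.reApplyInnerSelf_apply, PiLp.inner_apply]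
    simp only [RCLike.re_to_real, RCLike.inner_apply, conj_trivial, hTv, Finset.mul_sum]
    exact Finset.sum_congr rfl fun x _ => Finset.sum_congr rfl fun y _ => by ring
  -- A maximizer of the quadratic form on the unit sphere. Passing to absolute values keeps the norm
  -- and, since off-diagonal entries are nonnegative, does not lower the form, so |v| is a maximizer
  -- and hence an eigenvector.
  obtain ⟨v, hv, hmax⟩ := (isCompact_sphere (0 : EuclideanSpace ℝ S) 1).exists_isMaxOn
    ((NormedSpace.sphere_nonempty).2 zero_le_one) T.reApplyInnerSelf_continuous.continuousOn
  set w : EuclideanSpace ℝ S := WithLp.toLp 2 fun x => |v x| with hw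
  have hwn : ‖w‖ = 1 := by
    rw [mem_sphere_zero_iff_norm, EuclideanSpace.norm_eq] at hv
    rw [EuclideanSpace.norm_eq]
    simpa [hw] using hv
  have hwmax : IsMaxOn T.reApplyInnerSelf (Metric.sphere 0 ‖w‖) w := by
    rw [hwn]
    intro u hu
    refine le_trans (b := T.reApplyInnerSelf v) (hmax hu) ?_
    show T.reApplyInnerSelf v ≤ T.reApplyInnerSelf w
    simp only [hq]
    refine Finset.sum_le_sum fun x _ => Finset.sum_le_sum fun y _ => ?_
    by_cases hxy : x = y
    · subst hxy
      simp [hw]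
    · refine mul_le_mul_of_nonneg_left ?_ (h.nonneg x y hxy)
      simp only [hw, ← abs_mul]
      exact le_abs_self _
  have hw0 : w ≠ 0 := by
    intro h0
    simp [h0] at hwn
  have heig := hsa.hasEigenvector_of_isMaxOn hw0 hwmax
  obtain ⟨μ, hμ⟩ : ∃ μ : ℝ, T w = μ • w := ⟨_, heig.apply_eq_smul⟩
  have hμ' : Q.mulVec (fun x => |v x|) = μ • fun x => |v x| := by
    ext x
    exact congrArg (fun u : EuclideanSpace ℝ S => u x) hμ
  refine ⟨μ, fun x => |v x|, fun x => ?_, hμ', ?_⟩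
  -- Strict positivity: |v| is fixed by the exponential of Q − μ, whose entries are all positive by
  -- connectedness, and |v| is not zero.
  · have hfix := exp_mulVec_of_mulVec_eq_zero (Q - μ • (1 : Matrix S S ℝ)) (fun x => |v x|)
      (by rw [Matrix.sub_mulVec, hμ', Matrix.smul_mulVec, Matrix.one_mulVec, sub_self]) 1
      zero_le_one
    rw [← hfix]
    obtain ⟨y, hy⟩ : ∃ y, v y ≠ 0 := by
      by_contra! hcon
      exact hw0 (by ext x; simp [hw, hcon])
    exact Finset.sum_pos' (fun z _ => mul_nonneg
        ((h.sub_smul_one μ).exp_smul_apply_pos x z zero_lt_one).le (abs_nonneg _))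
      ⟨y, Finset.mem_univ y, mul_pos ((h.sub_smul_one μ).exp_smul_apply_pos x y zero_lt_one)
        (abs_pos.2 hy)⟩
  · have h1 := EuclideanSpace.norm_eq w
    rw [hwn] at h1
    have h2 := (Real.sqrt_eq_one.1 h1.symm)
    simpa [dotProduct, hw, ← sq] using h2

end PerronFrobenius

/-! ### Tilted generators, their symmetries and their eigenvectors. -/

namespace JumpSystem

variable {S A N : Type*} [Fintype S] [DecidableEq S] (M : JumpSystem S A N)

/-- The generator in which every jump from `x` to `y` gets the additional factor `g x y`. -/
def tiltedMatrix (α : A) (g : S → S → ℝ) : Matrix S S ℝ :=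
  Matrix.of fun x y => if x = y then -M.escape α x else M.rate α x y * g x y

theorem tiltedMatrix_apply_self (α : A) (g : S → S → ℝ) (x : S) :
    M.tiltedMatrix α g x x = -M.escape α x := by
  simp [tiltedMatrix]

theorem tiltedMatrix_apply_ne (α : A) (g : S → S → ℝ) {x y : S} (h : x ≠ y) :
    M.tiltedMatrix α g x y = M.rate α x y * g x y := by
  simp [tiltedMatrix, h]

theorem tiltedMatrix_isConnectedRateMatrix (α : A) {g : S → S → ℝ} (hg : ∀ x y, 0 < g x y) :
    IsConnectedRateMatrix (M.tiltedMatrix α g) := by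
  refine ⟨fun x y hxy => ?_, fun x y => ?_⟩
  · rw [M.tiltedMatrix_apply_ne α g hxy]
    exact mul_nonneg (M.rate_nonneg α x y hxy) (hg x y).le
  · refine Relation.ReflTransGen.mono (fun u v huv => ⟨huv.1, ?_⟩) x y (M.connected α x y)
    rw [M.tiltedMatrix_apply_ne α g huv.1]
    exact mul_ne_zero huv.2 (hg u v).ne'

/-- The rates in the weight, multiplied by g, are the off-diagonal entries of the tilted matrix, and
the waiting factors come from its diagonal. All expectations in the theorem are evaluated through
this formula. -/
theorem pathIntegral_mul_weight {a : ℝ → A} {g : ℝ → S → S → ℝ} {s e : ℝ}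
    (hK : IsLocBddMatrix fun t => M.tiltedMatrix (a t) (g t)) (hse : s ≤ e) (φ χ : S → ℝ)
    {f : JumpPath S → ℝ}
    (hf : ∀ p : JumpPath S, p.jumpTime ∈ jumpTimes s e p.numJumps →
      f p = φ p.first * χ p.last *
        (∏ j : Fin p.numJumps, g (p.jumpTime j) (p.state j.castSucc) (p.state j.succ)) *
        M.weight s e a p) :
    pathIntegral s e f =
      φ ⬝ᵥ (propagator (fun t => M.tiltedMatrix (a t) (g t)) s e).mulVec χ := by
  refine pathIntegral_eq_propagator hK hse φ χ fun p hp ht => ?_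
  have h1 : ∏ j : Fin p.numJumps, M.tiltedMatrix (a (p.jumpTime j)) (g (p.jumpTime j))
      (p.state j.castSucc) (p.state j.succ) =
      (∏ j : Fin p.numJumps, M.rate (a (p.jumpTime j)) (p.state j.castSucc) (p.state j.succ)) *
      ∏ j : Fin p.numJumps, g (p.jumpTime j) (p.state j.castSucc) (p.state j.succ) := by
    rw [← Finset.prod_mul_distrib]
    exact Finset.prod_congr rfl fun j _ => M.tiltedMatrix_apply_ne _ _ (hp j)
  rw [hf p ht, h1, weight]
  simp only [tiltedMatrix_apply_self, intervalIntegral.integral_neg]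
  ring

/-- The generator tilted by the increments of a potential. -/
noncomputable def potentialMatrix (α : A) (h : S → ℝ) : Matrix S S ℝ :=
  M.tiltedMatrix α fun x y => Real.exp (h y - h x)

/-- The generator tilted by half of the nonequilibrium part of the entropy production. -/
noncomputable def halfMatrix (α : A) : Matrix S S ℝ :=
  M.tiltedMatrix α fun x y => Real.exp (-M.psi α x y / 2)

theorem sum_eq_add_sum_ne {S : Type*} [Fintype S] [DecidableEq S] (f : S → ℝ) (x : S) :
    ∑ y, f y = f x + ∑ y : S with y ≠ x, f y := by
  rw [← Finset.add_sum_erase _ _ (Finset.mem_univ x)]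
  congr 2
  ext y; simp

/-- Tilting by a potential conjugates the generator by diag(e^h): the right null vector 1 becomes
e^{-h}, and the left null vector ρ becomes ρ e^h. -/
theorem potentialMatrix_mulVec (α : A) (h : S → ℝ) :
    (M.potentialMatrix α h).mulVec (fun x => Real.exp (-h x)) = 0 := by
  ext x
  simp only [Matrix.mulVec, dotProduct, Pi.zero_apply]
  rw [sum_eq_add_sum_ne _ x, potentialMatrix, tiltedMatrix_apply_self]
  have : ∀ y ∈ Finset.univ.filter (fun y => y ≠ x),
      M.tiltedMatrix α (fun x y => Real.exp (h y - h x)) x y * Real.exp (-h y) =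
        M.rate α x y * Real.exp (-h x) := by
    intro y hy
    rw [M.tiltedMatrix_apply_ne _ _ (by simpa using Ne.symm (Finset.mem_filter.1 hy).2), mul_assoc,
      ← Real.exp_add]
    ring_nf
  rw [Finset.sum_congr rfl this, ← Finset.sum_mul, escape]
  ring

/-- The source of the identity: e^{-ψ_{x→y}} = (R_{y→x}/R_{x→y}) e^{β(H_x - H_y)}, so multiplication
by R_{x→y} gives the work-tilted rate of the opposite jump. -/
theorem potentialMatrix_transpose_apply (α : A) (x y : S) :
    (M.potentialMatrix α fun x => M.beta * M.energy (M.hamParam α) x).transpose x y =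
      M.tiltedMatrix α (fun x y => Real.exp (-M.psi α x y)) x y := by
  rw [Matrix.transpose_apply, potentialMatrix]
  by_cases hxy : x = y
  · subst hxy; rw [tiltedMatrix_apply_self, tiltedMatrix_apply_self]
  rw [M.tiltedMatrix_apply_ne _ _ hxy, M.tiltedMatrix_apply_ne _ _ (Ne.symm hxy)]
  -- For a vanishing rate ψ has no meaning; both rates of the pair vanish then, so the value that
  -- the logarithm assigns is irrelevant.
  by_cases h0 : M.rate α x y = 0
  · have : M.rate α y x = 0 := by
      by_contra hcon
      exact M.rate_ne_zero_symm α y x (Ne.symm hxy) hcon h0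
    rw [h0, this]; ring
  have h0' := M.rate_ne_zero_symm α x y hxy h0
  have hp : 0 < M.rate α x y := lt_of_le_of_ne (M.rate_nonneg α x y hxy) (Ne.symm h0)
  have hp' : 0 < M.rate α y x := lt_of_le_of_ne (M.rate_nonneg α y x (Ne.symm hxy)) (Ne.symm h0')
  rw [psi, theta, neg_sub, Real.exp_sub (_ * (_ - _)), Real.exp_log (div_pos hp hp'), mul_sub]
  field_simp

theorem potentialMatrix_transpose (α : A) :
    (M.potentialMatrix α fun x => M.beta * M.energy (M.hamParam α) x).transpose =
      M.tiltedMatrix α (fun x y => Real.exp (-M.psi α x y)) := by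
  ext x y
  exact M.potentialMatrix_transpose_apply α x y

/-- Half of ψ turns the rate into the geometric mean of the two opposite rates, up to conjugation by
e^{βH/2}. This makes the half-tilted generator similar to a symmetric matrix. -/
theorem halfMatrix_apply_ne (α : A) {x y : S} (hxy : x ≠ y) :
    M.halfMatrix α x y = Real.exp (M.beta * M.energy (M.hamParam α) x / 2) *
      √(M.rate α x y * M.rate α y x) * Real.exp (-(M.beta * M.energy (M.hamParam α) y / 2)) := by
  rw [halfMatrix, M.tiltedMatrix_apply_ne _ _ hxy]
  by_cases h0 : M.rate α x y = 0
  · simp [h0]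
  have h0' := M.rate_ne_zero_symm α x y hxy h0
  have hp : 0 < M.rate α x y := lt_of_le_of_ne (M.rate_nonneg α x y hxy) (Ne.symm h0)
  have hp' : 0 < M.rate α y x := lt_of_le_of_ne (M.rate_nonneg α y x (Ne.symm hxy)) (Ne.symm h0')
  rw [Real.sqrt_eq_rpow, Real.rpow_def_of_pos (mul_pos hp hp'), Real.log_mul h0 h0',
    ← Real.exp_add, ← Real.exp_add, psi, theta, Real.log_div h0 h0']
  nth_rewrite 1 [← Real.exp_log hp]
  rw [← Real.exp_add]
  ring_nf

/-- Long-time asymptotics of the semigroup generated by the half-tilted generator. -/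
theorem exists_halfMatrix_asymptotics [Nonempty S] (α : A) :
    ∃ (μ : ℝ) (v : S → ℝ), (∀ x, 0 < v x) ∧
      Tendsto (fun t : ℝ => Real.exp (-(μ * t)) • NormedSpace.exp (t • M.halfMatrix α)) atTop
        (𝓝 (Matrix.vecMulVec
          (fun x => Real.exp (M.beta * M.energy (M.hamParam α) x / 2) * v x)
          (fun x => Real.exp (-(M.beta * M.energy (M.hamParam α) x / 2)) * v x))) := by
  set k : S → ℝ := fun x => M.beta * M.energy (M.hamParam α) x / 2 with hk
  -- The symmetric form of the half-tilted generator; one positive eigenvector v of it provides both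
  -- the left and the right eigenvector.
  let B : Matrix S S ℝ := Matrix.of fun x y => if x = y then -M.escape α x else
    √(M.rate α x y * M.rate α y x)
  have hB : ∀ x y, M.halfMatrix α x y = Real.exp (k x) * B x y * Real.exp (-k y) := by
    intro x y
    by_cases hxy : x = y
    · subst hxy
      simp only [halfMatrix, tiltedMatrix_apply_self, B, Matrix.of_apply, if_true]
      rw [mul_right_comm, ← Real.exp_add, add_neg_cancel, Real.exp_zero, one_mul]
    · rw [M.halfMatrix_apply_ne α hxy]
      simp [B, hxy, hk]
  have hBc : IsConnectedRateMatrix B := by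
    refine ⟨fun x y hxy => ?_, fun x y => ?_⟩
    · simp only [B, Matrix.of_apply, hxy, if_false]
      exact Real.sqrt_nonneg _
    · refine Relation.ReflTransGen.mono (fun u v huv => ⟨huv.1, ?_⟩) x y (M.connected α x y)
      simp only [B, Matrix.of_apply, huv.1, if_false]
      refine (Real.sqrt_pos.2 (mul_pos ?_ ?_)).ne'
      · exact lt_of_le_of_ne (M.rate_nonneg α u v huv.1) (Ne.symm huv.2)
      · exact lt_of_le_of_ne (M.rate_nonneg α v u huv.1.symm)
          (Ne.symm (M.rate_ne_zero_symm α u v huv.1 huv.2))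
  have hBs : B.IsSymm := by
    ext x y
    by_cases hxy : x = y
    · subst hxy; rfl
    · simp [B, hxy, Ne.symm hxy, mul_comm]
  obtain ⟨μ, v, hv, hBv, hvv⟩ := hBc.exists_pos_eigenvector hBs
  have hBv' : ∀ x, ∑ y, B x y * v y = μ * v x := fun x => congrFun hBv x
  have hinv : ∀ x, Real.exp (-k x) * Real.exp (k x) = 1 := fun x => by
    rw [← Real.exp_add, neg_add_cancel, Real.exp_zero]
  have hM : IsConnectedRateMatrix (M.halfMatrix α) :=
    M.tiltedMatrix_isConnectedRateMatrix α fun x y => Real.exp_pos _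
  refine ⟨μ, v, hv, hM.tendsto_exp (r := fun x => Real.exp (k x) * v x)
    (l := fun x => Real.exp (-k x) * v x) (fun x => mul_pos (Real.exp_pos _) (hv x)) ?_ ?_ ?_⟩
  · ext x
    have : ∀ y, M.halfMatrix α x y * (Real.exp (k y) * v y) = Real.exp (k x) * (B x y * v y) := by
      intro y
      rw [hB]
      linear_combination Real.exp (k x) * (B x y * v y) * hinv y
    simp only [Matrix.mulVec, dotProduct, Pi.smul_apply, smul_eq_mul]
    rw [Finset.sum_congr rfl fun y _ => this y, ← Finset.mul_sum, hBv']
    ring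
  · ext y
    have : ∀ x, (Real.exp (-k x) * v x) * M.halfMatrix α x y =
        Real.exp (-k y) * (B y x * v x) := by
      intro x
      rw [hB, ← hBs.apply x y]
      linear_combination Real.exp (-k y) * (B y x * v x) * hinv x
    simp only [Matrix.vecMul, dotProduct, Pi.smul_apply, smul_eq_mul]
    rw [Finset.sum_congr rfl fun x _ => this x, ← Finset.mul_sum, hBv']
    ring
  · rw [← hvv]
    simp only [dotProduct]
    refine Finset.sum_congr rfl fun x _ => ?_
    linear_combination v x * v x * hinv x

section Steady

variable [Nonempty S]

theorem steady_nonneg (α : A) (x : S) : 0 ≤ M.steady α x :=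
  (Classical.choose_spec (M.exists_isStationary α)).1 x

theorem sum_steady (α : A) : ∑ x, M.steady α x = 1 :=
  (Classical.choose_spec (M.exists_isStationary α)).2.1

theorem steady_balance (α : A) (x : S) :
    -M.escape α x * M.steady α x + ∑ y : S with y ≠ x, M.steady α y * M.rate α y x = 0 :=
  (Classical.choose_spec (M.exists_isStationary α)).2.2 x

/-- Nonnegativity and normalization suffice; strict positivity of the stationary distribution is not
required. -/
theorem steady_dotProduct_pos (α : A) {v : S → ℝ} (hv : ∀ x, 0 < v x) : 0 < M.steady α ⬝ᵥ v := by
  obtain ⟨x, hx⟩ : ∃ x, M.steady α x ≠ 0 := by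
    by_contra! hcon
    have := M.sum_steady α
    simp [hcon] at this
  exact Finset.sum_pos' (fun y _ => mul_nonneg (M.steady_nonneg α y) (hv y).le)
    ⟨x, Finset.mem_univ x, mul_pos (lt_of_le_of_ne (M.steady_nonneg α x) hx.symm) (hv x)⟩

theorem vecMul_potentialMatrix (α : A) (h : S → ℝ) :
    Matrix.vecMul (fun x => M.steady α x * Real.exp (h x)) (M.potentialMatrix α h) = 0 := by
  ext y
  simp only [Matrix.vecMul, dotProduct, Pi.zero_apply]
  rw [sum_eq_add_sum_ne _ y, potentialMatrix, tiltedMatrix_apply_self]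
  have : ∀ x ∈ Finset.univ.filter (fun x => x ≠ y),
      M.steady α x * Real.exp (h x) * M.tiltedMatrix α (fun x y => Real.exp (h y - h x)) x y =
        M.steady α x * M.rate α x y * Real.exp (h y) := by
    intro x hx
    rw [M.tiltedMatrix_apply_ne _ _ (Finset.mem_filter.1 hx).2, Real.exp_sub]
    field_simp
  rw [Finset.sum_congr rfl this, ← Finset.sum_mul]
  linear_combination Real.exp (h y) * M.steady_balance α y

theorem steady_dotProduct_potential (α : A) (h : S → ℝ) :
    (fun x => M.steady α x * Real.exp (h x)) ⬝ᵥ (fun x => Real.exp (-h x)) = 1 := by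
  rw [← M.sum_steady α]
  refine Finset.sum_congr rfl fun x _ => ?_
  rw [mul_assoc, ← Real.exp_add, add_neg_cancel, Real.exp_zero, mul_one]

theorem tendsto_exp_potentialMatrix (α : A) (h : S → ℝ) :
    Tendsto (fun t : ℝ => NormedSpace.exp (t • M.potentialMatrix α h)) atTop
      (𝓝 (Matrix.vecMulVec (fun x => Real.exp (-h x))
        (fun x => M.steady α x * Real.exp (h x)))) :=
  (M.tiltedMatrix_isConnectedRateMatrix α fun _ _ => Real.exp_pos _).tendsto_exp_of_mulVec_eq_zero
    (fun _ => Real.exp_pos _) (M.potentialMatrix_mulVec α h) (M.vecMul_potentialMatrix α h)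
    (M.steady_dotProduct_potential α h)

end Steady

/-! ### Generators along a protocol, and their time reversal. -/

section Protocol

variable {M} {τo : ℝ} {a : ℝ → A}

omit [Fintype S] [DecidableEq S] in
theorem IsProtocol.reverse (ha : M.IsProtocol τo a) : M.IsProtocol τo (reverseProtocol a) where
  eq_initial t ht := by
    simp only [reverseProtocol, neg_neg]
    exact ha.eq_final _ (le_neg.1 ht)
  eq_final t ht := ha.eq_initial _ (neg_le_neg ht)
  measurable_rate x y hxy := (ha.measurable_rate x y hxy).comp measurable_neg
  measurable_energy x := (ha.measurable_energy x).comp measurable_neg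
  bounded_rate x y hxy := (ha.bounded_rate x y hxy).imp fun _ h t => h (-t)
  bounded_energy x := (ha.bounded_energy x).imp fun _ h t => h (-t)

theorem isLocBddMatrix_tiltedMatrix (ha : M.IsProtocol τo a) {g : ℝ → S → S → ℝ}
    (hm : ∀ x y, x ≠ y → Measurable fun t => M.rate (a t) x y * g t x y)
    (hb : ∀ s e x y, x ≠ y → ∃ C, ∀ t ∈ Set.Icc s e, |M.rate (a t) x y * g t x y| ≤ C) :
    IsLocBddMatrix fun t => M.tiltedMatrix (a t) (g t) := by
  have hb' : ∀ s e x y, ∃ C, ∀ t ∈ Set.Icc s e, |M.tiltedMatrix (a t) (g t) x y| ≤ C := by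
    intro s e x y
    by_cases hxy : x = y
    · subst hxy
      have h1 : ∀ y, ∃ C, y ≠ x → ∀ t, M.rate (a t) x y ≤ C := fun y => by
        by_cases hyx : y = x
        · exact ⟨0, fun h => absurd hyx h⟩
        · exact (ha.bounded_rate x y (Ne.symm hyx)).imp fun C h _ => h
      choose C hC using h1
      refine ⟨∑ y : S with y ≠ x, C y, fun t _ => ?_⟩
      rw [tiltedMatrix_apply_self, abs_neg, escape, abs_of_nonneg]
      · exact Finset.sum_le_sum fun y hy => hC y (Finset.mem_filter.1 hy).2 t
      · exact Finset.sum_nonneg fun y hy => M.rate_nonneg _ _ _ (Finset.mem_filter.1 hy).2.symm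
    · simp only [M.tiltedMatrix_apply_ne _ _ hxy]
      exact hb s e x y hxy
  choose C hC using hb'
  refine ⟨fun x y => ?_, fun s e => ⟨∑ x, ∑ y, |C s e x y|, fun t ht x y => ?_⟩⟩
  · by_cases hxy : x = y
    · subst hxy
      simp only [tiltedMatrix_apply_self, escape]
      exact (Finset.measurable_fun_sum _ fun y hy =>
        ha.measurable_rate x y (Finset.mem_filter.1 hy).2.symm).neg
    · simp only [M.tiltedMatrix_apply_ne _ _ hxy]
      exact hm x y hxy
  · exact ((hC s e x y t ht).trans (le_abs_self _)).trans <|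
      (Finset.single_le_sum (f := fun y => |C s e x y|) (fun _ _ => abs_nonneg _)
        (Finset.mem_univ y)).trans
      (Finset.single_le_sum (f := fun x => ∑ y, |C s e x y|)
        (fun _ _ => Finset.sum_nonneg fun _ _ => abs_nonneg _) (Finset.mem_univ x))

theorem isLocBddMatrix_potentialMatrix (ha : M.IsProtocol τo a) {h : ℝ → S → ℝ}
    (hm : ∀ x, Measurable fun t => h t x) (hb : ∀ x, ∃ C, ∀ t, |h t x| ≤ C) :
    IsLocBddMatrix fun t => M.potentialMatrix (a t) (h t) := by
  refine isLocBddMatrix_tiltedMatrix ha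
    (fun x y hxy => (ha.measurable_rate x y hxy).mul ((hm y).sub (hm x)).exp) fun _ _ x y hxy => ?_
  obtain ⟨C, hC⟩ := ha.bounded_rate x y hxy
  obtain ⟨D, hD⟩ := hb x
  obtain ⟨E, hE⟩ := hb y
  refine ⟨C * Real.exp (E + D), fun t _ => ?_⟩
  have h0 := M.rate_nonneg (a t) x y hxy
  rw [abs_of_nonneg (mul_nonneg h0 (Real.exp_pos _).le)]
  refine mul_le_mul (hC t) (Real.exp_le_exp.2 ?_) (Real.exp_pos _).le (h0.trans (hC t))
  linarith [(abs_le.1 (hE t)).2, (abs_le.1 (hD t)).1]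

theorem isLocBddMatrix_workMatrix (ha : M.IsProtocol τo a) :
    IsLocBddMatrix fun t =>
      M.potentialMatrix (a t) fun x => M.beta * M.energy (M.hamParam (a t)) x :=
  isLocBddMatrix_potentialMatrix ha (fun x => (ha.measurable_energy x).const_mul _) fun x => by
    obtain ⟨C, hC⟩ := ha.bounded_energy x
    refine ⟨|M.beta| * C, fun t => ?_⟩
    rw [abs_mul]
    exact mul_le_mul_of_nonneg_left (hC t) (abs_nonneg _)

theorem isLocBddMatrix_masterMatrix (ha : M.IsProtocol τo a) :
    IsLocBddMatrix fun t => M.potentialMatrix (a t) 0 :=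
  isLocBddMatrix_potentialMatrix ha (fun _ => measurable_const) fun _ => ⟨0, by simp⟩

/-- The transposition identity taken along the protocol: the reversed work dynamics is the Ψ-tilted
dynamics of the reversed protocol. -/
theorem reverseMatrix_workMatrix :
    reverseMatrix (fun t =>
      M.potentialMatrix (a t) fun x => M.beta * M.energy (M.hamParam (a t)) x) =
    fun t => M.tiltedMatrix (reverseProtocol a t)
      (fun x y => Real.exp (-M.psi (reverseProtocol a t) x y)) := by
  funext t
  exact M.potentialMatrix_transpose (a (-t))

theorem masterMatrix_eq (α : A) : M.potentialMatrix α 0 = M.tiltedMatrix α fun _ _ => 1 := by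
  simp [potentialMatrix]

/-- The propagator of a protocol, with the constant parts separated off. -/
theorem propagator_protocol (hτ : 0 ≤ τo) (ha : M.IsProtocol τo a) (q : A → Matrix S S ℝ)
    (hK : IsLocBddMatrix fun t => q (a t)) {T : ℝ} (hT : τo ≤ T) :
    propagator (fun t => q (a t)) (-T) T =
      NormedSpace.exp ((T - τo) • q (a (-τo))) * propagator (fun t => q (a t)) (-τo) τo *
        NormedSpace.exp ((T - τo) • q (a τo)) := by
  have h1 : propagator (fun t => q (a t)) (-T) (-τo) =
      NormedSpace.exp ((T - τo) • q (a (-τo))) := by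
    rw [propagator_congr hK (isLocBddMatrix_const (q (a (-τo)))) (neg_le_neg hT) fun t ht => by
      rw [ha.eq_initial t ht.2.le], propagator_const _ (neg_le_neg hT)]
    congr 2; ring
  have h2 : propagator (fun t => q (a t)) τo T = NormedSpace.exp ((T - τo) • q (a τo)) := by
    rw [propagator_congr hK (isLocBddMatrix_const (q (a τo))) hT fun t ht => by
      rw [ha.eq_final t ht.1.le], propagator_const _ hT]
  rw [← h1, ← h2, propagator_mul_propagator hK (neg_le_neg hT) (neg_le_self hτ),
    propagator_mul_propagator hK (by linarith) hT]

end Protocol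

end JumpSystem

/-- Long-time limit of a matrix element between two rank-one projections. -/
theorem tendsto_dotProduct_mul_mulVec {S ι : Type*} [Fintype S] {F : Filter ι}
    {E₁ B E₂ : ι → Matrix S S ℝ} {ρ r₁ l₁ u w r₂ l₂ z : S → ℝ} {c : ℝ}
    (h₁ : Tendsto E₁ F (𝓝 (Matrix.vecMulVec r₁ l₁)))
    (hB : Tendsto B F (𝓝 (c • Matrix.vecMulVec u w)))
    (h₂ : Tendsto E₂ F (𝓝 (Matrix.vecMulVec r₂ l₂))) :
    Tendsto (fun i => ρ ⬝ᵥ (E₁ i * B i * E₂ i).mulVec z) F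
      (𝓝 (c * (ρ ⬝ᵥ r₁) * (l₁ ⬝ᵥ u) * (w ⬝ᵥ r₂) * (l₂ ⬝ᵥ z))) := by
  have hc : Continuous fun X : Matrix S S ℝ => ρ ⬝ᵥ X.mulVec z :=
    continuous_const.dotProduct (continuous_id.matrix_mulVec continuous_const)
  have hlim : c * (ρ ⬝ᵥ r₁) * (l₁ ⬝ᵥ u) * (w ⬝ᵥ r₂) * (l₂ ⬝ᵥ z) =
      ρ ⬝ᵥ (Matrix.vecMulVec r₁ l₁ * (c • Matrix.vecMulVec u w) *
        Matrix.vecMulVec r₂ l₂).mulVec z := by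
    simp only [← Matrix.mulVec_mulVec, Matrix.vecMulVec_mulVec, Matrix.smul_mulVec,
      Matrix.mulVec_smul, dotProduct_smul, op_smul_eq_smul, smul_eq_mul]
    ring
  rw [hlim]
  exact (hc.tendsto _).comp ((h₁.mul hB).mul h₂)

/-! ### The expectations of the theorem as matrix elements. -/

namespace JumpSystem

variable {S A N : Type*} [Fintype S] [DecidableEq S] (M : JumpSystem S A N)

omit [Fintype S] [DecidableEq S] in
theorem psiOn_eq_sum {s e : ℝ} (a : ℝ → A) {p : JumpPath S}
    (hp : p.jumpTime ∈ jumpTimes s e p.numJumps) :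
    M.psiOn s e a p =
      ∑ j : Fin p.numJumps, M.psi (a (p.jumpTime j)) (p.state j.castSucc) (p.state j.succ) :=
  Finset.sum_congr rfl fun j _ =>
    Set.indicator_of_mem (Set.mem_Icc.2 ⟨(hp.2 j).1.le, (hp.2 j).2.le⟩) _

omit [Fintype S] [DecidableEq S] in
theorem exp_neg_psiOn_div_two {s e : ℝ} (α : A) {p : JumpPath S}
    (hp : p.jumpTime ∈ jumpTimes s e p.numJumps) :
    Real.exp (-M.psiOn s e (fun _ => α) p / 2) =
      ∏ j : Fin p.numJumps, Real.exp (-M.psi α (p.state j.castSucc) (p.state j.succ) / 2) := by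
  rw [M.psiOn_eq_sum _ hp, ← Real.exp_sum, ← Finset.sum_neg_distrib, Finset.sum_div]

theorem expectFrom_half {s e : ℝ} (hse : s ≤ e) (α : A) (x : S) :
    M.expectFrom s e (fun _ => α) x (fun p => Real.exp (-M.psiOn s e (fun _ => α) p / 2)) =
      (NormedSpace.exp ((e - s) • M.halfMatrix α)).mulVec (fun _ => 1) x := by
  rw [expectFrom, M.pathIntegral_mul_weight (a := fun _ => α)
    (g := fun _ x y => Real.exp (-M.psi α x y / 2)) (isLocBddMatrix_const (M.halfMatrix α)) hse
    (fun z => if z = x then 1 else 0) (fun _ => 1)]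
  · have := propagator_const (M.halfMatrix α) hse
    rw [halfMatrix] at this ⊢
    rw [this]
    simp [dotProduct]
  · intro p hp
    rw [M.exp_neg_psiOn_div_two α hp]
    ring

/-- The matrix factor of the quarter weight for a jump at time `t`. -/
noncomputable def quarterFactor (τ : ℝ) (b : ℝ → A) (t : ℝ) (x y : S) : ℝ :=
  Real.exp (-((Set.Icc (-τ) (-τ / 2)).indicator (fun _ => M.psi (b (-τ)) x y) t +
    (Set.Icc (τ / 2) τ).indicator (fun _ => M.psi (b τ) x y) t) / 2)

omit [Fintype S] [DecidableEq S] in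
theorem quarterWeight_eq_prod (τ : ℝ) (b : ℝ → A) (p : JumpPath S) :
    M.quarterWeight τ b p = ∏ j : Fin p.numJumps,
      M.quarterFactor τ b (p.jumpTime j) (p.state j.castSucc) (p.state j.succ) := by
  simp only [quarterWeight, quarterFactor, psiOn]
  rw [← Real.exp_sum, ← Finset.sum_add_distrib, ← Finset.sum_neg_distrib, Finset.sum_div]

omit [Fintype S] [DecidableEq S] in
theorem measurable_quarterFactor (τ : ℝ) (b : ℝ → A) (x y : S) :
    Measurable fun t => M.quarterFactor τ b t x y :=
  (((measurable_const.indicator measurableSet_Icc).add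
    (measurable_const.indicator measurableSet_Icc)).neg.div_const 2).exp

omit [Fintype S] [DecidableEq S] in
theorem abs_quarterFactor_le (τ : ℝ) (b : ℝ → A) (x y : S) (t : ℝ) :
    |M.quarterFactor τ b t x y| ≤
      Real.exp ((|M.psi (b (-τ)) x y| + |M.psi (b τ) x y|) / 2) := by
  rw [quarterFactor, abs_of_pos (Real.exp_pos _), Real.exp_le_exp]
  have h : ∀ (s : Set ℝ) (c : ℝ), -s.indicator (fun _ => c) t ≤ |c| := by
    intro s c
    by_cases ht : t ∈ s
    · rw [Set.indicator_of_mem ht]; exact neg_le_abs c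
    · rw [Set.indicator_of_notMem ht, neg_zero]; exact abs_nonneg c
  linarith [h (Set.Icc (-τ) (-τ / 2)) (M.psi (b (-τ)) x y), h (Set.Icc (τ / 2) τ) (M.psi (b τ) x y)]

section Protocol

variable {M} {τo : ℝ} {a : ℝ → A}

theorem isLocBddMatrix_tiltedMatrix_mul (ha : M.IsProtocol τo a) {g m : ℝ → S → S → ℝ}
    (hK : IsLocBddMatrix fun t => M.tiltedMatrix (a t) (g t))
    (hm : ∀ x y, Measurable fun t => m t x y) (hb : ∀ x y, ∃ C, ∀ t, |m t x y| ≤ C) :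
    IsLocBddMatrix fun t => M.tiltedMatrix (a t) (fun x y => g t x y * m t x y) := by
  refine isLocBddMatrix_tiltedMatrix ha (fun x y hxy => ?_) fun s e x y hxy => ?_
  · have := (hK.measurable x y).mul (hm x y)
    simp only [M.tiltedMatrix_apply_ne _ _ hxy] at this
    simpa only [Pi.mul_def, mul_assoc] using this
  · obtain ⟨C, hC⟩ := hK.bounded s e
    obtain ⟨D, hD⟩ := hb x y
    refine ⟨C * D, fun t ht => ?_⟩
    have h1 := hC t ht x y
    rw [M.tiltedMatrix_apply_ne _ _ hxy] at h1
    rw [← mul_assoc, abs_mul]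
    exact mul_le_mul h1 (hD t) (abs_nonneg _) ((abs_nonneg _).trans h1)

omit [Fintype S] [DecidableEq S] in
theorem IsProtocol.measurable_psi (ha : M.IsProtocol τo a) {x y : S} (hxy : x ≠ y) :
    Measurable fun t => M.psi (a t) x y :=
  ((ha.measurable_rate x y hxy).div (ha.measurable_rate y x hxy.symm)).log.sub
    (((ha.measurable_energy x).sub (ha.measurable_energy y)).const_mul _)

/-- The rates need not be bounded away from zero, so ψ itself may be unbounded. The product R e^{-ψ}
is nevertheless bounded, being an entry of a transposed work matrix. -/
theorem isLocBddMatrix_psiFactor (ha : M.IsProtocol τo a) (c d : ℝ) :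
    IsLocBddMatrix fun t => M.tiltedMatrix (a t) (fun x y =>
      Real.exp (-(Set.Icc c d).indicator (fun t => M.psi (a t) x y) t)) := by
  have hfull : IsLocBddMatrix fun t => M.tiltedMatrix (a t)
      (fun x y => Real.exp (-M.psi (a t) x y)) := by
    have := (isLocBddMatrix_workMatrix ha.reverse).reverse
    rw [reverseMatrix_workMatrix] at this
    simpa only [reverseProtocol, neg_neg] using this
  refine isLocBddMatrix_tiltedMatrix ha (fun x y hxy => ?_) fun s e x y hxy => ?_
  · exact (ha.measurable_rate x y hxy).mul
      (((ha.measurable_psi hxy).indicator measurableSet_Icc).neg.exp)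
  · obtain ⟨C, hC⟩ := hfull.bounded s e
    obtain ⟨D, hD⟩ := ha.bounded_rate x y hxy
    refine ⟨max C D, fun t ht => ?_⟩
    by_cases htm : t ∈ Set.Icc c d
    · have := hC t ht x y
      rw [M.tiltedMatrix_apply_ne _ _ hxy] at this
      rw [Set.indicator_of_mem htm]
      exact this.trans (le_max_left _ _)
    · rw [Set.indicator_of_notMem htm, neg_zero, Real.exp_zero, mul_one,
        abs_of_nonneg (M.rate_nonneg _ _ _ hxy)]
      exact (hD t).trans (le_max_right _ _)

/-- The condition τo ≤ τ/2 puts both outer quarters into the constant parts of the protocol, where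
only the half tilt acts; in the middle only g acts. -/
theorem propagator_quarterFactor (hτo : 0 < τo) (ha : M.IsProtocol τo a) {τ : ℝ} (hτ : τo ≤ τ / 2)
    {g : ℝ → S → S → ℝ} (hg : IsLocBddMatrix fun t => M.tiltedMatrix (a t) (g t))
    (hg₁ : ∀ t < -(τ / 2), g t = fun _ _ => 1) (hg₂ : ∀ t > τ / 2, g t = fun _ _ => 1)
    (hK : IsLocBddMatrix fun t =>
      M.tiltedMatrix (a t) (fun x y => g t x y * M.quarterFactor τ a t x y)) :
    propagator (fun t => M.tiltedMatrix (a t) fun x y => g t x y * M.quarterFactor τ a t x y)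
        (-τ) τ =
      NormedSpace.exp ((τ / 2) • M.halfMatrix (a (-τo))) *
        propagator (fun t => M.tiltedMatrix (a t) (g t)) (-(τ / 2)) (τ / 2) *
        NormedSpace.exp ((τ / 2) • M.halfMatrix (a τo)) := by
  have e1 : a (-τ) = a (-τo) := ha.eq_initial _ (by linarith)
  have e2 : a τ = a τo := ha.eq_final _ (by linarith)
  have hneg : -τ / 2 = -(τ / 2) := neg_div _ _
  rw [← propagator_mul_propagator hK (show -τ ≤ τ / 2 by linarith) (show τ / 2 ≤ τ by linarith),
    ← propagator_mul_propagator hK (show -τ ≤ -(τ / 2) by linarith)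
      (show -(τ / 2) ≤ τ / 2 by linarith)]
  congr 1
  · congr 1
    · rw [propagator_congr hK (isLocBddMatrix_const (M.halfMatrix (a (-τo)))) (by linarith)
        fun t ht => ?_, propagator_const _ (by linarith)]
      · congr 2; ring
      · have ht1 : t ∈ Set.Icc (-τ) (-τ / 2) := ⟨ht.1.le, by rw [hneg]; exact ht.2.le⟩
        have ht2 : t ∉ Set.Icc (τ / 2) τ := fun h => by linarith [h.1, ht.2]
        simp only [quarterFactor, Set.indicator_of_mem ht1, Set.indicator_of_notMem ht2, e1,
          hg₁ t ht.2, ha.eq_initial t (by linarith [ht.2]), one_mul, add_zero, halfMatrix]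
    · refine propagator_congr hK hg (by linarith) fun t ht => ?_
      have ht1 : t ∉ Set.Icc (-τ) (-τ / 2) := fun h => by
        have := h.2
        rw [hneg] at this
        linarith [ht.1]
      have ht2 : t ∉ Set.Icc (τ / 2) τ := fun h => by linarith [h.1, ht.2]
      simp only [quarterFactor, Set.indicator_of_notMem ht1, Set.indicator_of_notMem ht2,
        add_zero, neg_zero, zero_div, Real.exp_zero, mul_one]
  · rw [propagator_congr hK (isLocBddMatrix_const (M.halfMatrix (a τo))) (by linarith)
      fun t ht => ?_, propagator_const _ (by linarith)]
    · congr 2; ring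
    · have ht1 : t ∉ Set.Icc (-τ) (-τ / 2) := fun h => by
        have := h.2
        rw [hneg] at this
        linarith [ht.1]
      have ht2 : t ∈ Set.Icc (τ / 2) τ := ⟨ht.1.le, ht.2.le⟩
      simp only [quarterFactor, Set.indicator_of_mem ht2, Set.indicator_of_notMem ht1, e2,
        hg₂ t ht.1, ha.eq_final t (by linarith [ht.1]), one_mul, zero_add, halfMatrix]

variable [Nonempty S]

variable (M) in
theorem expectStTo_half {s e : ℝ} (hse : s ≤ e) (α : A) (x : S) :
    M.expectStTo s e (fun _ => α) x (fun p => Real.exp (-M.psiOn s e (fun _ => α) p / 2)) =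
      Matrix.vecMul (M.steady α) (NormedSpace.exp ((e - s) • M.halfMatrix α)) x := by
  rw [expectStTo, M.pathIntegral_mul_weight (a := fun _ => α)
    (g := fun _ x y => Real.exp (-M.psi α x y / 2)) (isLocBddMatrix_const (M.halfMatrix α)) hse
    (M.steady α) (fun z => if z = x then 1 else 0)]
  · have := propagator_const (M.halfMatrix α) hse
    rw [halfMatrix] at this ⊢
    rw [this, Matrix.dotProduct_mulVec]
    simp [dotProduct]
  · intro p hp
    rw [M.exp_neg_psiOn_div_two α hp]
    ring

theorem expectSt_mul_quarterWeight (hτo : 0 < τo) (ha : M.IsProtocol τo a) {τ : ℝ}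
    (hτ : τo ≤ τ / 2)
    {g : ℝ → S → S → ℝ} (hg : IsLocBddMatrix fun t => M.tiltedMatrix (a t) (g t))
    (hg₁ : ∀ t < -(τ / 2), g t = fun _ _ => 1) (hg₂ : ∀ t > τ / 2, g t = fun _ _ => 1)
    {f : JumpPath S → ℝ} (hf : ∀ p : JumpPath S, f p = ∏ j : Fin p.numJumps,
      g (p.jumpTime j) (p.state j.castSucc) (p.state j.succ)) :
    M.expectSt (-τ) τ a (fun p => f p * M.quarterWeight τ a p) =
      M.steady (a (-τo)) ⬝ᵥ (NormedSpace.exp ((τ / 2) • M.halfMatrix (a (-τo))) *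
        propagator (fun t => M.tiltedMatrix (a t) (g t)) (-(τ / 2)) (τ / 2) *
        NormedSpace.exp ((τ / 2) • M.halfMatrix (a τo))).mulVec (fun _ => 1) := by
  have hK := isLocBddMatrix_tiltedMatrix_mul ha hg (M.measurable_quarterFactor τ a)
    fun x y => ⟨_, M.abs_quarterFactor_le τ a x y⟩
  rw [expectSt, M.pathIntegral_mul_weight hK (by linarith) (M.steady (a (-τ))) (fun _ => 1),
    propagator_quarterFactor hτo ha hτ hg hg₁ hg₂ hK, ha.eq_initial (-τ) (by linarith)]
  intro p _
  rw [hf, quarterWeight_eq_prod, ← Finset.prod_mul_distrib]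
  ring

/-- Summation by parts moves the energy increments at fixed state into differences H_y − H_x at the
jumps and two boundary terms. The jump terms are the potential tilt; the boundary terms become the
test vectors. -/
theorem expectSt_exp_work (ha : M.IsProtocol τo a) {s e : ℝ} (hse : s ≤ e) :
    M.expectSt s e a (fun p => Real.exp (-M.beta * M.work s e a p)) =
      (fun x => M.steady (a s) x * Real.exp (M.beta * M.energy (M.hamParam (a s)) x)) ⬝ᵥ
        (propagator (fun t => M.potentialMatrix (a t)
          fun x => M.beta * M.energy (M.hamParam (a t)) x) s e).mulVec
          (fun y => Real.exp (-(M.beta * M.energy (M.hamParam (a e)) y))) := by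
  refine M.pathIntegral_mul_weight (isLocBddMatrix_workMatrix ha) hse _ _ fun p _ => ?_
  have hw : M.work s e a p = _ :=
    JumpPath.sum_sub_time (fun t x => M.energy (M.hamParam (a t)) x) s e p
  beta_reduce
  rw [hw, ← Real.exp_sum]
  simp only [← mul_sub, ← Finset.mul_sum]
  rw [mul_assoc (M.steady (a s) p.first), ← Real.exp_add,  mul_assoc (M.steady (a s) p.first),
    ← Real.exp_add, mul_comm (Real.exp _)]
  congr 3
  ring

end Protocol

end JumpSystem

/-! ### Long-time limits of work, modified expectations and free energy. -/

namespace JumpSystem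

variable {S A N : Type*} [Fintype S] [DecidableEq S] [Nonempty S] {M : JumpSystem S A N}

variable (M) in
/-- The generator that incorporates the work done in a jump. -/
noncomputable def workMatrix (α : A) : Matrix S S ℝ :=
  M.potentialMatrix α fun x => M.beta * M.energy (M.hamParam α) x

variable (M) in
/-- The expectation of `exp (-β W)` over the time interval `[-τo, τo]` of the operation. -/
noncomputable def workExpectation (τo : ℝ) (a : ℝ → A) : ℝ :=
  (fun x => M.steady (a (-τo)) x * Real.exp (M.beta * M.energy (M.hamParam (a (-τo))) x)) ⬝ᵥ
    (propagator (fun t => M.workMatrix (a t)) (-τo) τo).mulVec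
      (fun y => Real.exp (-(M.beta * M.energy (M.hamParam (a τo)) y)))

variable {τo : ℝ} {a : ℝ → A}

theorem workExpectation_pos (hτo : 0 < τo) (ha : M.IsProtocol τo a) :
    0 < M.workExpectation τo a := by
  have hK : IsLocBddMatrix fun t => M.workMatrix (a t) := isLocBddMatrix_workMatrix ha
  have hnn : ∀ t ∈ Set.Icc (-τo) τo, ∀ x y, x ≠ y → 0 ≤ M.workMatrix (a t) x y := fun t _ =>
    (M.tiltedMatrix_isConnectedRateMatrix (a t) fun _ _ => Real.exp_pos _).nonneg
  have hse : -τo ≤ τo := by linarith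
  have hpos : ∀ x, 0 < Real.exp (M.beta * M.energy (M.hamParam (a (-τo))) x) *
      (propagator (fun t => M.workMatrix (a t)) (-τo) τo).mulVec
      (fun y => Real.exp (-(M.beta * M.energy (M.hamParam (a τo)) y))) x := fun x =>
    mul_pos (Real.exp_pos _) <| Finset.sum_pos'
      (fun y _ => mul_nonneg (propagator_nonneg hK hse hnn x y) (Real.exp_pos _).le)
      ⟨x, Finset.mem_univ x, mul_pos (propagator_self_pos hK hse hnn x) (Real.exp_pos _)⟩
  have := M.steady_dotProduct_pos (a (-τo)) hpos
  simpa only [workExpectation, dotProduct, mul_assoc] using this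

/-- The expectation of `exp (-β W)` does not change when the time interval is extended. -/
theorem expectSt_exp_work_eq (hτo : 0 < τo) (ha : M.IsProtocol τo a) {τ : ℝ} (hτ : τo ≤ τ) :
    M.expectSt (-τ) τ a (fun p => Real.exp (-M.beta * M.work (-τ) τ a p)) =
      M.workExpectation τo a := by
  have hP := propagator_protocol hτo.le ha M.workMatrix (isLocBddMatrix_workMatrix ha) hτ
  rw [expectSt_exp_work ha (by linarith), ha.eq_initial (-τ) (by linarith), ha.eq_final τ hτ]
  simp only [workMatrix] at hP
  -- The test vectors are precisely the null vectors of the work matrix, so the two constant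
  -- stretches of the protocol drop out.
  rw [hP, ← Matrix.mulVec_mulVec, ← Matrix.mulVec_mulVec,
    exp_mulVec_of_mulVec_eq_zero _ _ (M.potentialMatrix_mulVec _ _) _ (by linarith),
    Matrix.dotProduct_mulVec,
    vecMul_exp_of_vecMul_eq_zero _ _ (M.vecMul_potentialMatrix _ _) _ (by linarith)]
  rfl

theorem tendsto_div_two_sub_atTop (c : ℝ) :
    Tendsto (fun τ : ℝ => τ / 2 - c) atTop atTop :=
  tendsto_atTop_add_const_right _ _ (tendsto_id.atTop_div_const two_pos)

/-- On either side of the operation the semigroup tends to a rank-one projection. The scalar left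
between the two projections is the left null vector at α paired, through the propagator, with the
right null vector at α', which is the work expectation. -/
theorem tendsto_propagator_workMatrix (hτo : 0 < τo) (ha : M.IsProtocol τo a) :
    Tendsto (fun τ : ℝ => propagator (fun t => M.workMatrix (a t)) (-(τ / 2)) (τ / 2)) atTop
      (𝓝 (M.workExpectation τo a • Matrix.vecMulVec
        (fun x => Real.exp (-(M.beta * M.energy (M.hamParam (a (-τo))) x)))
        (fun x => M.steady (a τo) x * Real.exp (M.beta * M.energy (M.hamParam (a τo)) x)))) := by
  have h1 := (M.tendsto_exp_potentialMatrix (a (-τo))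
    fun x => M.beta * M.energy (M.hamParam (a (-τo))) x).comp (tendsto_div_two_sub_atTop τo)
  have h2 := (M.tendsto_exp_potentialMatrix (a τo)
    fun x => M.beta * M.energy (M.hamParam (a τo)) x).comp (tendsto_div_two_sub_atTop τo)
  have h3 := (h1.mul_const (propagator (fun t => M.workMatrix (a t)) (-τo) τo)).mul h2
  rw [Matrix.vecMulVec_mul, Matrix.vecMulVec_mul_vecMulVec, ← Matrix.dotProduct_mulVec] at h3
  rw [← Matrix.vecMulVec_smul]
  refine h3.congr' ?_
  filter_upwards [eventually_ge_atTop (2 * τo)] with τ hτ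
  exact (propagator_protocol hτo.le ha M.workMatrix (isLocBddMatrix_workMatrix ha)
    (by linarith)).symm

/-- The same limit for zero potential; the scalar is the total probability, hence 1. It is kept as
an explicit factor to match `tendsto_dotProduct_mul_mulVec`. -/
theorem tendsto_propagator_masterMatrix (hτo : 0 < τo) (ha : M.IsProtocol τo a) :
    Tendsto (fun τ : ℝ => propagator (fun t => M.potentialMatrix (a t) 0) (-(τ / 2)) (τ / 2)) atTop
      (𝓝 ((1 : ℝ) • Matrix.vecMulVec (fun _ => 1) (M.steady (a τo)))) := by
  have hK := isLocBddMatrix_masterMatrix ha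
  have hnull : ∀ α, (M.potentialMatrix α 0).mulVec (fun _ => 1) = 0 := fun α => by
    simpa using M.potentialMatrix_mulVec α 0
  have hlim : ∀ α, Tendsto (fun τ : ℝ => NormedSpace.exp ((τ / 2 - τo) • M.potentialMatrix α 0))
      atTop (𝓝 (Matrix.vecMulVec (fun _ => 1) (M.steady α))) := fun α => by
    simpa [Function.comp_def] using
      (M.tendsto_exp_potentialMatrix α 0).comp (tendsto_div_two_sub_atTop τo)
  have h3 := ((hlim (a (-τo))).mul_const
    (propagator (fun t => M.potentialMatrix (a t) 0) (-τo) τo)).mul (hlim (a τo))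
  rw [Matrix.vecMulVec_mul, Matrix.vecMulVec_mul_vecMulVec, ← Matrix.dotProduct_mulVec,
    propagator_mulVec_of_forall hK (by linarith) _ fun t _ => hnull (a t)] at h3
  have h1 : M.steady (a (-τo)) ⬝ᵥ (fun _ => (1 : ℝ)) = 1 := by
    simpa [dotProduct] using M.sum_steady (a (-τo))
  rw [h1, Matrix.vecMulVec_smul] at h3
  refine h3.congr' ?_
  filter_upwards [eventually_ge_atTop (2 * τo)] with τ hτ
  exact (propagator_protocol hτo.le ha (fun α => M.potentialMatrix α 0) hK (by linarith)).symm

/-- The numerator of the modified expectation for the reversed protocol: its middle factor is the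
transposed forward work propagator, and the outer factors appear with α' first. -/
theorem expectSt_psi_mul_quarterWeight (hτo : 0 < τo) (ha : M.IsProtocol τo a) {τ : ℝ}
    (hτ : τo ≤ τ / 2) :
    M.expectSt (-τ) τ (reverseProtocol a) (fun p =>
        Real.exp (-M.psiOn (-τ / 2) (τ / 2) (reverseProtocol a) p) *
          M.quarterWeight τ (reverseProtocol a) p) =
      M.steady (a τo) ⬝ᵥ (NormedSpace.exp ((τ / 2) • M.halfMatrix (a τo)) *
        (propagator (fun t => M.workMatrix (a t)) (-(τ / 2)) (τ / 2)).transpose *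
        NormedSpace.exp ((τ / 2) • M.halfMatrix (a (-τo)))).mulVec (fun _ => 1) := by
  have hb := ha.reverse
  have hneg : -τ / 2 = -(τ / 2) := neg_div _ _
  have hg := isLocBddMatrix_psiFactor hb (-(τ / 2)) (τ / 2)
  have hW : IsLocBddMatrix fun t => M.workMatrix (a t) := isLocBddMatrix_workMatrix ha
  rw [expectSt_mul_quarterWeight hτo hb hτ hg (fun t ht => ?_) (fun t ht => ?_) (fun p => ?_)]
  · have hprop : propagator (fun t => M.tiltedMatrix (reverseProtocol a t) fun x y =>
        Real.exp (-(Set.Icc (-(τ / 2)) (τ / 2)).indicator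
          (fun t => M.psi (reverseProtocol a t) x y) t)) (-(τ / 2)) (τ / 2) =
        (propagator (fun t => M.workMatrix (a t)) (-(τ / 2)) (τ / 2)).transpose := by
      rw [← propagator_reverse hW (by linarith), neg_neg]
      refine propagator_congr hg hW.reverse (by linarith) fun t ht => ?_
      have := congrFun (reverseMatrix_workMatrix (M := M) (a := a)) t
      simp only [workMatrix, this, Set.indicator_of_mem (Set.Ioo_subset_Icc_self ht)]
    rw [hprop]
    simp only [reverseProtocol, neg_neg]
  · funext x y
    rw [Set.indicator_of_notMem fun h => (ht.trans_le h.1).false, neg_zero, Real.exp_zero]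
  · funext x y
    rw [Set.indicator_of_notMem fun h => (ht.trans_le h.2).false, neg_zero, Real.exp_zero]
  · rw [psiOn, ← Real.exp_sum, ← Finset.sum_neg_distrib, hneg]

theorem expectSt_quarterWeight (hτo : 0 < τo) (ha : M.IsProtocol τo a) {τ : ℝ}
    (hτ : τo ≤ τ / 2) :
    M.expectSt (-τ) τ a (fun p => M.quarterWeight τ a p) =
      M.steady (a (-τo)) ⬝ᵥ (NormedSpace.exp ((τ / 2) • M.halfMatrix (a (-τo))) *
        propagator (fun t => M.potentialMatrix (a t) 0) (-(τ / 2)) (τ / 2) *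
        NormedSpace.exp ((τ / 2) • M.halfMatrix (a τo))).mulVec (fun _ => 1) := by
  have hK := isLocBddMatrix_masterMatrix ha
  simp only [masterMatrix_eq] at hK ⊢
  rw [← expectSt_mul_quarterWeight hτo ha hτ hK (fun _ _ => rfl) (fun _ _ => rfl)
    (f := fun _ => 1) (fun p => by simp)]
  simp only [one_mul]

theorem smul_sandwich {S : Type*} [Fintype S] (c₁ c₂ : ℝ) (ρ z : S → ℝ) (E₁ B E₂ : Matrix S S ℝ) :
    ρ ⬝ᵥ ((c₁ • E₁) * B * (c₂ • E₂)).mulVec z = c₁ * c₂ * (ρ ⬝ᵥ (E₁ * B * E₂).mulVec z) := by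
  simp only [Matrix.smul_mul, Matrix.mul_smul, Matrix.smul_mulVec, dotProduct_smul, smul_eq_mul]
  ring

variable (M) in
/-- The defining limit of the nonequilibrium free energy, in terms of the eigenvectors of the
half-tilted generator. -/
theorem tendsto_free_energy (α : A) (x : S) {μ : ℝ} {v : S → ℝ} (hv : ∀ x, 0 < v x)
    (hlim : Tendsto (fun t : ℝ => Real.exp (-(μ * t)) • NormedSpace.exp (t • M.halfMatrix α)) atTop
        (𝓝 (Matrix.vecMulVec
          (fun x => Real.exp (M.beta * M.energy (M.hamParam α) x / 2) * v x)
          (fun x => Real.exp (-(M.beta * M.energy (M.hamParam α) x / 2)) * v x)))) :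
    Tendsto (fun τ : ℝ => Real.exp (-M.beta * M.energy (M.hamParam α) x) *
      (M.expectFrom (-τ) (-τ / 2) (fun _ => α) x
          (fun p => Real.exp (-M.psiOn (-τ) (-τ / 2) (fun _ => α) p / 2)) /
        M.expectStTo (τ / 2) τ (fun _ => α) x
          (fun p => Real.exp (-M.psiOn (τ / 2) τ (fun _ => α) p / 2))))
    atTop (𝓝 (((fun x => Real.exp (-(M.beta * M.energy (M.hamParam α) x / 2)) * v x) ⬝ᵥ
        (fun _ => 1)) /
      (M.steady α ⬝ᵥ fun x => Real.exp (M.beta * M.energy (M.hamParam α) x / 2) * v x))) := by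
  set r := fun x => Real.exp (M.beta * M.energy (M.hamParam α) x / 2) * v x with hr
  set l := fun x => Real.exp (-(M.beta * M.energy (M.hamParam α) x / 2)) * v x with hl
  have hρr : 0 < M.steady α ⬝ᵥ r := M.steady_dotProduct_pos α fun x => mul_pos (Real.exp_pos _) (hv x)
  have hlx : 0 < l x := mul_pos (Real.exp_pos _) (hv x)
  have h := hlim.comp (tendsto_id.atTop_div_const two_pos)
  have hnum : Tendsto (fun τ : ℝ => (Real.exp (-(μ * (τ / 2))) •
      NormedSpace.exp ((τ / 2) • M.halfMatrix α)).mulVec (fun _ => 1) x) atTop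
      (𝓝 ((Matrix.vecMulVec r l).mulVec (fun _ => 1) x)) :=
    tendsto_pi_nhds.1 (((continuous_id.matrix_mulVec continuous_const).tendsto _).comp h) x
  have hden : Tendsto (fun τ : ℝ => Matrix.vecMul (M.steady α) (Real.exp (-(μ * (τ / 2))) •
      NormedSpace.exp ((τ / 2) • M.halfMatrix α)) x) atTop
      (𝓝 (Matrix.vecMul (M.steady α) (Matrix.vecMulVec r l) x)) :=
    tendsto_pi_nhds.1 (((continuous_const.matrix_vecMul continuous_id).tendsto _).comp h) x
  have e1 : (Matrix.vecMulVec r l).mulVec (fun _ => 1) x = (l ⬝ᵥ fun _ => 1) * r x := by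
    rw [Matrix.vecMulVec_mulVec, op_smul_eq_smul, Pi.smul_apply, smul_eq_mul]
  have e2 : Matrix.vecMul (M.steady α) (Matrix.vecMulVec r l) x = (M.steady α ⬝ᵥ r) * l x := by
    rw [Matrix.vecMul_vecMulVec, Pi.smul_apply, smul_eq_mul]
  rw [e1] at hnum
  rw [e2] at hden
  have key := (hnum.div hden (mul_pos hρr hlx).ne').const_mul
    (Real.exp (-M.beta * M.energy (M.hamParam α) x))
  have hval : Real.exp (-M.beta * M.energy (M.hamParam α) x) *
      (((l ⬝ᵥ fun _ => 1) * r x) / ((M.steady α ⬝ᵥ r) * l x)) =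
      (l ⬝ᵥ fun _ => 1) / (M.steady α ⬝ᵥ r) := by
    -- The prefactor e^{-βH_x} converts r x into l x, which cancels the l x of the denominator; this
    -- removes the dependence on x.
    have h1 : Real.exp (-M.beta * M.energy (M.hamParam α) x) * r x = l x := by
      simp only [hr, hl]
      rw [← mul_assoc, ← Real.exp_add]
      ring_nf
    rw [mul_div_assoc', mul_left_comm, h1, mul_div_mul_right _ _ hlx.ne']
  rw [hval] at key
  refine key.congr' ?_
  filter_upwards [eventually_gt_atTop 0] with τ hτ
  rw [M.expectFrom_half (by linarith), M.expectStTo_half (by linarith)]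
  have t1 : -τ / 2 - -τ = τ / 2 := by ring
  have t2 : τ - τ / 2 = τ / 2 := by ring
  rw [t1, t2, Pi.div_apply, Matrix.smul_mulVec, Matrix.vecMul_smul, Pi.smul_apply, Pi.smul_apply,
    smul_eq_mul, smul_eq_mul, mul_div_mul_left _ _ (Real.exp_pos _).ne']

end JumpSystem

/-! ### Comparison of the limits. -/

theorem theorem2 {S A N : Type*} [Fintype S] [DecidableEq S] [Nonempty S]
    (M : JumpSystem S A N) :
    ∃ F : A → ℝ, M.IsFreeEnergy F ∧
      ∀ (τo : ℝ) (a : ℝ → A), 0 < τo → M.IsProtocol τo a →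
        ∃ L L' : ℝ, 0 < L ∧
          Tendsto
            (fun τ : ℝ => M.expectSt (-τ) τ a fun p => Real.exp (-M.beta * M.work (-τ) τ a p))
            atTop (𝓝 L) ∧
          Tendsto
            (fun τ : ℝ => M.expectPsiMod τ (reverseProtocol a) fun p =>
              Real.exp (-M.psiOn (-τ / 2) (τ / 2) (reverseProtocol a) p))
            atTop (𝓝 L') ∧
          L = Real.exp (-M.beta * (F (a τo) - F (a (-τo)))) * L' := by
  choose μ v hv hlim using M.exists_halfMatrix_asymptotics
  set r : A → S → ℝ := fun α x => Real.exp (M.beta * M.energy (M.hamParam α) x / 2) * v α x with hr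
  set l : A → S → ℝ := fun α x => Real.exp (-(M.beta * M.energy (M.hamParam α) x / 2)) * v α x
    with hl
  have hρr : ∀ α, 0 < M.steady α ⬝ᵥ r α := fun α =>
    M.steady_dotProduct_pos α fun x => mul_pos (Real.exp_pos _) (hv α x)
  have hl1 : ∀ α, 0 < l α ⬝ᵥ (fun _ => (1 : ℝ)) := fun α => Finset.sum_pos
    (fun x _ => mul_pos (mul_pos (Real.exp_pos _) (hv α x)) one_pos) Finset.univ_nonempty
  -- The free energy is obtained by solving e^{-βF} = (l·1)/(ρ·r) for F; both scalar products are
  -- positive.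
  have hF : ∀ α, Real.exp (-M.beta *
      (-(Real.log ((l α ⬝ᵥ fun _ => (1 : ℝ)) / (M.steady α ⬝ᵥ r α)) / M.beta))) =
      (l α ⬝ᵥ fun _ => (1 : ℝ)) / (M.steady α ⬝ᵥ r α) := fun α => by
    rw [neg_mul_neg, mul_div_cancel₀ _ M.beta_pos.ne', Real.exp_log (div_pos (hl1 α) (hρr α))]
  refine ⟨fun α => -(Real.log ((l α ⬝ᵥ fun _ => (1 : ℝ)) / (M.steady α ⬝ᵥ r α)) / M.beta),
    fun α x => ?_, fun τo a hτo ha => ?_⟩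
  · rw [hF α]
    exact M.tendsto_free_energy α x (hv α) (hlim α)
  set α := a (-τo) with hα
  set α' := a τo with hα'
  have hlim2 : ∀ α, Tendsto (fun τ : ℝ => Real.exp (-(μ α * (τ / 2))) •
      NormedSpace.exp ((τ / 2) • M.halfMatrix α)) atTop (𝓝 (Matrix.vecMulVec (r α) (l α))) :=
    fun α => (hlim α).comp (tendsto_id.atTop_div_const two_pos)
  have hW := ((continuous_id.matrix_transpose).tendsto _).comp
    (JumpSystem.tendsto_propagator_workMatrix hτo ha)
  rw [id, Matrix.transpose_smul, Matrix.transpose_vecMulVec] at hW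
  have hN := tendsto_dotProduct_mul_mulVec (ρ := M.steady α') (z := fun _ => 1)
    (hlim2 α') hW (hlim2 α)
  have hB := JumpSystem.tendsto_propagator_masterMatrix hτo ha.reverse
  have hb1 : reverseProtocol a τo = α := rfl
  have hb2 : reverseProtocol a (-τo) = α' := by rw [reverseProtocol, neg_neg]
  rw [hb1] at hB
  have hD := tendsto_dotProduct_mul_mulVec (ρ := M.steady α') (z := fun _ => 1)
    (hlim2 α') hB (hlim2 α)
  -- This identity and the next match the null vectors of the work matrix with the half-tilted
  -- eigenvectors: e^{βH} l = r and e^{-βH} r = l.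
  have hlk : l α' ⬝ᵥ (fun x => M.steady α' x * Real.exp (M.beta * M.energy (M.hamParam α') x)) =
      M.steady α' ⬝ᵥ r α' := by
    refine Finset.sum_congr rfl fun x _ => ?_
    have : Real.exp (-(M.beta * M.energy (M.hamParam α') x / 2)) *
        Real.exp (M.beta * M.energy (M.hamParam α') x) =
        Real.exp (M.beta * M.energy (M.hamParam α') x / 2) := by
      rw [← Real.exp_add]; ring_nf
    simp only [hl, hr]
    linear_combination v α' x * M.steady α' x * this
  have hsr : (fun x => Real.exp (-(M.beta * M.energy (M.hamParam α) x))) ⬝ᵥ r α =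
      l α ⬝ᵥ fun _ => 1 := by
    refine Finset.sum_congr rfl fun x _ => ?_
    have : Real.exp (-(M.beta * M.energy (M.hamParam α) x)) *
        Real.exp (M.beta * M.energy (M.hamParam α) x / 2) =
        Real.exp (-(M.beta * M.energy (M.hamParam α) x / 2)) := by
      rw [← Real.exp_add]; ring_nf
    simp only [hl, hr]
    linear_combination v α x * this
  rw [hlk, hsr] at hN
  have hD0 : 1 * (M.steady α' ⬝ᵥ r α') * (l α' ⬝ᵥ fun _ => (1 : ℝ)) * (M.steady α ⬝ᵥ r α) *
      (l α ⬝ᵥ fun _ => (1 : ℝ)) ≠ 0 := by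
    have := hρr α; have := hρr α'; have := hl1 α; have := hl1 α'
    positivity
  refine ⟨M.workExpectation τo a, _, JumpSystem.workExpectation_pos hτo ha, ?_,
    (hN.div hD hD0).congr' ?_, ?_⟩
  · refine tendsto_const_nhds.congr' ?_
    filter_upwards [eventually_ge_atTop τo] with τ hτ
    exact (JumpSystem.expectSt_exp_work_eq hτo ha hτ).symm
  · filter_upwards [eventually_ge_atTop (2 * τo)] with τ hτ
    rw [JumpSystem.expectPsiMod, JumpSystem.expectSt_psi_mul_quarterWeight hτo ha (by linarith),
      JumpSystem.expectSt_quarterWeight hτo ha.reverse (by linarith), hb1, hb2]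
    simp only [Function.comp_apply, Pi.div_apply, id]
    -- Numerator and denominator carry the same normalizations e^{-μτ/2} from the two outer
    -- quarters, so the ratio needs no rescaling.
    rw [JumpSystem.smul_sandwich, JumpSystem.smul_sandwich, mul_div_mul_left]
    exact (mul_pos (Real.exp_pos _) (Real.exp_pos _)).ne'
  · rw [mul_sub, Real.exp_sub, hF, hF]
    have := (hρr α).ne'; have := (hρr α').ne'; have := (hl1 α).ne'; have := (hl1 α').ne'
    field_simp
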